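/- Let $V$ be a finite set partitioned into parts $P_1,\dots,P_k$ ($k\ge 1$) with budgets $n_1,\dots,n_k\ge 1$; call $A\subseteq V$ feasible if $|A\cap P_a|\le n_a$ for all $a\in[k]$. Let $f\colon 2^V\to\mathbb{R}_{\ge 0}$ be submodular (not necessarily monotone). Write $n_{\min}=\min_a n_a$ and choose the parameters as follows. (1) Small budget case $n_{\min}\le 10$: $p=0.3$, and $d_a=1,\ 1.7961,\ 2.0654,\ 2.1627,\ 2.2107,\ 2.2387,\ 2.2567,\ 2.2692,\ 2.2783,\ 2.2852$ for $n_a=1,2,\dots,10$ respectively, and $d_a=\frac{1-p}{p}=\frac73$ for $n_a\ge 11$. (2) Large budget case $n_{\min}\ge 11$: $d_a=d:=1.9532$ for all $a$, and $p=\frac{1}{d+1}$. For $a\in[k]$ and $i\in\{1,\dots,n_a\}$ put $$c_a=\frac{1+d_a}{(1+d_a/n_a)^{n_a}-1},\qquad g_a(i)=\frac{c_a}{n_a}\Bigl(1+\frac{d_a}{n_a}\Bigr)^{i-1},\qquad Q_a=\max\Bigl\{1+c_a+d_a,\ \bigl(1-\tfrac1{n_a}\bigr)c_a+\tfrac1p\Bigr\}.$$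 Consider the following algorithm. Start with $S=\emptyset$ and thresholds $\beta_a=0$ for all $a$. The items of $V$ arrive one at a time in an arbitrary fixed order, and each item $t$ has a coin $Z_t\sim\mathrm{Ber}(p)$; the coins are independent. When $t\in P_a$ arrives, let $w_t=f(S\cup\{t\})-f(S)$. If $w_t-\beta_a\ge 0$ and $Z_t=1$, then: (i) if $|S\cap P_a|<n_a$, replace $S$ by $S\cup\{t\}$, and otherwise replace $S$ by $(S\setminus\{t'\})\cup\{t\}$, where $t'\in S\cap P_a$ has minimum weight $w_{t'}$ among the items in $S\cap P_a$ (ties are broken by an arbitrary fixed rule); (ii) then set $\beta_a=\sum_{i=1}^{n_a}w_a(i)\,g_a(i)$, where $w_a(i)$ is the $i$-th largest of the weights $w_j$, $j\in S\cap P_a$, counted with multiplicity, and $w_a(i)=0$ for $i>|S\cap P_a|$. After the last arrival return $S$. Then the returned set $S$ is always feasible, and for every feasible set $S^*$ (in particular for an optimal one) $$\mathbb{E}[f(S)]\ \ge\ \frac{1-p}{\max_{a}Q_a}\,f(S^*).$$ Moreover: (a) If $n_{\min}\le 10$, then $\frac{1-p}{Q_a}\ge 0.175,\ 0.18,\ 0.18,\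 0.182,\ 0.183,\ 0.183,\ 0.184,\ 0.185,\ 0.185,\ 0.185$ for $n_a=1,2,\dots,10$ respectively, and $\frac{1-p}{Q_a}\ge 0.1896\bigl(1-\frac{0.7771}{n_a}\bigr)$ for $n_a\ge 11$. (b) If $n_{\min}\ge 11$, then $\frac{1-p}{Q_a}\ge 0.1921\bigl(1-\frac{0.7676}{n_a}\bigr)$ for every $a$, and hence $\frac{1-p}{\max_a Q_a}\ge 0.1921\bigl(1-\frac{0.7676}{n_{\min}}\bigr)$. (c) For all budgets, $\frac{1-p}{\max_a Q_a}\ge 0.175$; and for every $\varepsilon>0$ there is an $N$ such that $\frac{1-p}{\max_a Q_a}\ge 0.1921-\varepsilon$ whenever $n_{\min}\ge N$ (for every $k$). -/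

import Mathlib

open MeasureTheory ProbabilityTheory

namespace PartitionSubmod

/-- Submodularity of a set function on the subsets of a finite ground set. -/
def Submodular {V : Type*} [DecidableEq V] (f : Finset V → ℝ) : Prop :=
  ∀ A B : Finset V, f (A ∪ B) + f (A ∩ B) ≤ f A + f B

/-- The items of `A` that lie in part `a`; the partition is the map sending an item to
the index of its part. -/
def inPart {V : Type*} {k : ℕ} (part : V → Fin k) (a : Fin k) (A : Finset V) : Finset V :=
  A.filter (fun t => part t = a)

/-- Independent sets of the partition matroid with budgets `n`. -/
def Independent {V : Type*} {k : ℕ} (part : V → Fin k) (n : Fin k → ℕ) (A : Finset V) : Prop :=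
  ∀ a, (inPart part a A).card ≤ n a

/-- A tie-breaking rule: on arrival of `t`, it returns an element of the nonempty set `A` whose
weight is minimal in `A`. -/
def IsArgminRule {V : Type*} (argmin : V → Finset V → (V → ℝ) → V) : Prop :=
  ∀ (t : V) (A : Finset V) (w : V → ℝ), A.Nonempty →
    argmin t A w ∈ A ∧ ∀ i ∈ A, w (argmin t A w) ≤ w i

/-- The `i`-th largest weight (`i = 1, 2, …`, counted with multiplicity) of the items in `A`,
and `0` for `i > |A|`. -/
noncomputable def ithLargest {V : Type*} (A : Finset V) (w : V → ℝ) (i : ℕ) : ℝ :=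
  ((A.val.map w).sort (fun x y => y ≤ x)).getD (i - 1) 0

/-- `c_a` as a function of the budget `n = n_a` and of `d = d_a`. -/
noncomputable def cCoef (n : ℕ) (d : ℝ) : ℝ :=
  (1 + d) / ((1 + d / n) ^ n - 1)

/-- `g_a(i)` as a function of the budget `n = n_a`, of `d = d_a` and of `i = 1, …, n`. -/
noncomputable def gCoef (n : ℕ) (d : ℝ) (i : ℕ) : ℝ :=
  cCoef n d / n * (1 + d / n) ^ (i - 1)

/-- The state of the algorithm: the current solution, the recorded weights of the items that
have arrived, and the thresholds of the parts. -/
structure AlgState (V : Type*) (k : ℕ) where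
  S : Finset V
  w : V → ℝ
  β : Fin k → ℝ

/-- The treatment of the arriving item `t` when its coin shows `z`. -/
noncomputable def step {V : Type*} [DecidableEq V] {k : ℕ} (f : Finset V → ℝ)
    (part : V → Fin k) (n : Fin k → ℕ) (d : Fin k → ℝ) (argmin : V → Finset V → (V → ℝ) → V)
    (z : Bool) (s : AlgState V k) (t : V) : AlgState V k :=
  let a := part t
  let w := Function.update s.w t (f (insert t s.S) - f s.S)
  if w t - s.β a ≥ 0 ∧ z = true then
    let S' := if (inPart part a s.S).card < n a then insert t s.S
      else insert t (s.S.erase (argmin t (inPart part a s.S) w))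
    { S := S'
      w := w
      β := Function.update s.β a
        (∑ i ∈ Finset.Icc 1 (n a), ithLargest (inPart part a S') w i * gCoef (n a) (d a) i) }
  else { S := s.S, w := w, β := s.β }

/-- The output of the algorithm when the items arrive in the order `σ` and the coin of item `t`
shows `z t`. -/
noncomputable def run {V : Type*} [DecidableEq V] {k : ℕ} (f : Finset V → ℝ)
    (part : V → Fin k) (n : Fin k → ℕ) (d : Fin k → ℝ) (argmin : V → Finset V → (V → ℝ) → V)
    (σ : List V) (z : V → Bool) : Finset V :=
  (σ.foldl (fun s t => step f part n d argmin (z t) s t)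
    { S := ∅, w := fun _ => 0, β := fun _ => 0 }).S

/-- The minimum budget. -/
def minBudget {k : ℕ} [NeZero k] (n : Fin k → ℕ) : ℕ :=
  Finset.univ.inf' Finset.univ_nonempty n

/-- The subsampling probability `p`: `0.3` in the small budget case, and `1 / (d + 1)` with
`d = 1.9532` in the large budget case. -/
noncomputable def probParam {k : ℕ} [NeZero k] (n : Fin k → ℕ) : ℝ :=
  if minBudget n ≤ 10 then 0.3 else 1 / (1.9532 + 1)

/-- The values of `d_a` in the small budget case, as a function of `n_a ≥ 1`. The last value is
`(1 - p) / p` for `p = 0.3`. -/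
noncomputable def smallD : ℕ → ℝ
  | 1 => 1
  | 2 => 1.7961
  | 3 => 2.0654
  | 4 => 2.1627
  | 5 => 2.2107
  | 6 => 2.2387
  | 7 => 2.2567
  | 8 => 2.2692
  | 9 => 2.2783
  | 10 => 2.2852
  | _ => (1 - 0.3) / 0.3

/-- The parameters `d_a`. -/
noncomputable def dParam {k : ℕ} [NeZero k] (n : Fin k → ℕ) (a : Fin k) : ℝ :=
  if minBudget n ≤ 10 then smallD (n a) else 1.9532

/-- `Q_a = max {1 + c_a + d_a, (1 - 1 / n_a) c_a + 1 / p}` for the above parameters. -/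
noncomputable def Q {k : ℕ} [NeZero k] (n : Fin k → ℕ) (a : Fin k) : ℝ :=
  max (1 + cCoef (n a) (dParam n a) + dParam n a)
    ((1 - 1 / (n a : ℝ)) * cCoef (n a) (dParam n a) + 1 / probParam n)

/-- The approximation ratio `(1 - p) / max_a Q_a`. -/
noncomputable def ratio {k : ℕ} [NeZero k] (n : Fin k → ℕ) : ℝ :=
  (1 - probParam n) / Finset.univ.sup' Finset.univ_nonempty (Q n)

/-- The lower bounds on `(1 - p) / Q_a` in the small budget case, as a function of `n_a ≥ 1`. -/
noncomputable def smallBound : ℕ → ℝ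
  | 1 => 0.175
  | 2 => 0.18
  | 3 => 0.18
  | 4 => 0.182
  | 5 => 0.183
  | 6 => 0.183
  | 7 => 0.184
  | 8 => 0.185
  | 9 => 0.185
  | 10 => 0.185
  | m => 0.1896 * (1 - 0.7771 / (m : ℝ))

end PartitionSubmod

/-! Fix a feasible `A`. Let T be the set of all items ever accepted, including those replaced later,
and let q be the maximum of the Q_a. The ratio follows from two estimates.

(1) E f(A ∪ T) ≥ (1 - p) f(A): an item enters T only if its own coin shows `true`, so a nonnegative
submodular function loses at most the fraction p of its value (`Submodular.exists_le_expect`).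

(2) E f(A ∪ T) ≤ q E f(S) (`expect_sub_le`). Call an item seen if it lies in T or is an arrived item
of `A`. Weights are marginals over the current S, so submodularity gives f(S) ≥ f(∅) + w(S) and
f(seen) ≤ f(∅) + w(seen) (`Invariant`). The potential f(∅) + w(seen) + ∑ slack_a β_a - q (f(∅) +
w(S)) is at most 0 at the start, dominates f(A ∪ T) - q f(S) at the end, and does not increase in
expectation (`potential_step`). Indeed an arriving item of `A` trades one unit of slack, worth β_a,
for its weight. A positive surplus w_t - β_a appears whatever the coin shows, but is paid for only
on acceptance, hence the factor 1 / p in Q_a. Acceptance must also pay for the rise of β_a. The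
geometric coefficients g_a and the normalization c_a ((1 + d_a / n_a) ^ n_a - 1) = 1 + d_a make this
rise linear in w_t, β_a and the lost weight (`threshold_increment`).

The numerical bounds rest on (1 + d/n)^n ≥ e^d (1 - d²/(2n)) for large budgets and on rational
arithmetic for budgets up to 10. -/

namespace PartitionSubmod

/-! ### Geometric sums of decreasing lists under insertion and deletion -/

section GeometricSums

/-- The sum `∑ i, ρ ^ i * l[i]` over the entries of a list. -/
noncomputable def geomSum (ρ : ℝ) : List ℝ → ℝ
  | [] => 0
  | x :: l => x + ρ * geomSum ρ l

theorem geomSum_append_singleton (ρ : ℝ) (l : List ℝ) (m : ℝ) :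
    geomSum ρ (l ++ [m]) = geomSum ρ l + ρ ^ l.length * m := by
  induction l with
  | nil => simp [geomSum]
  | cons x l ih => simp only [List.cons_append, geomSum, ih, List.length_cons]; ring

theorem geomSum_eq_sum_range (ρ : ℝ) (l : List ℝ) (n : ℕ) (h : l.length ≤ n) :
    geomSum ρ l = ∑ i ∈ Finset.range n, l.getD i 0 * ρ ^ i := by
  induction l generalizing n with
  | nil => simp [geomSum]
  | cons x l ih =>
    obtain ⟨n, rfl⟩ : ∃ k, n = k + 1 := ⟨n - 1, by simp at h; omega⟩
    rw [Finset.sum_range_succ', geomSum, ih n (by simpa using h), Finset.mul_sum, add_comm]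
    congr 1
    · exact Finset.sum_congr rfl fun i _ => by simp only [List.getD_cons_succ]; ring
    · simp

/-- Sorting decreasingly pairs large entries with small powers of `ρ ≥ 1`, so moving `w` to the
front can only increase the sum. -/
theorem geomSum_orderedInsert_le {ρ : ℝ} (hρ : 1 ≤ ρ) (w : ℝ) (l : List ℝ) :
    geomSum ρ (l.orderedInsert (fun x y => y ≤ x) w) ≤ w + ρ * geomSum ρ l := by
  induction l with
  | nil => simp [geomSum]
  | cons x l ih =>
    by_cases h : x ≤ w
    · rw [List.orderedInsert_cons_of_le (r := fun x y : ℝ => y ≤ x) l h]; exact le_rfl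
    · rw [List.orderedInsert_of_not_le (r := fun x y : ℝ => y ≤ x) l h]
      simp only [geomSum]
      nlinarith [mul_le_mul_of_nonneg_left ih (by linarith : (0 : ℝ) ≤ ρ),
        mul_nonneg (sub_nonneg.2 hρ) (sub_nonneg.2 (not_le.1 h).le)]

/-- Entry by entry, the list with `w` inserted dominates `l ++ [m]`. This makes the thresholds
monotone under replacement. -/
theorem geomSum_append_le_orderedInsert {ρ : ℝ} (hρ : 1 ≤ ρ) (l : List ℝ) {m w : ℝ}
    (hl : l.Pairwise (fun x y => y ≤ x)) (hm : ∀ x ∈ l, m ≤ x) (hw : m ≤ w) :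
    geomSum ρ (l ++ [m]) ≤ geomSum ρ (l.orderedInsert (fun x y => y ≤ x) w) := by
  induction l generalizing w with
  | nil => simpa [geomSum] using hw
  | cons x l ih =>
    rw [List.pairwise_cons] at hl
    have hρ0 : (0 : ℝ) ≤ ρ := by linarith
    have hml : ∀ y ∈ l, m ≤ y := fun y hy => hm y (List.mem_cons_of_mem _ hy)
    by_cases h : x ≤ w
    · rw [List.orderedInsert_cons_of_le (r := fun x y : ℝ => y ≤ x) l h]
      -- When `w` lands in front, `x` takes the role of `w` for the tail, so `w` must be generalized
      -- in the induction.
      have h1 := ih hl.2 hml (hm x List.mem_cons_self)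
      have h2 : l.orderedInsert (fun x y => y ≤ x) x = x :: l := by
        cases l with
        | nil => rfl
        | cons y l =>
          exact List.orderedInsert_cons_of_le (r := fun x y : ℝ => y ≤ x) l
            (hl.1 y List.mem_cons_self)
      rw [h2] at h1
      rw [List.cons_append, geomSum, geomSum]
      linarith [mul_le_mul_of_nonneg_left h1 hρ0]
    · rw [List.orderedInsert_of_not_le (r := fun x y : ℝ => y ≤ x) l h]
      rw [List.cons_append, geomSum, geomSum]
      linarith [mul_le_mul_of_nonneg_left (ih hl.2 hml hw) hρ0]

theorem mul_geom_le_geomSum {ρ : ℝ} (hρ : 0 ≤ ρ) (l : List ℝ) {m : ℝ} (hm : ∀ x ∈ l, m ≤ x) :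
    m * ∑ i ∈ Finset.range l.length, ρ ^ i ≤ geomSum ρ l := by
  induction l with
  | nil => simp [geomSum]
  | cons x l ih =>
    have h1 := ih fun y hy => hm y (List.mem_cons_of_mem _ hy)
    have h2 : ∑ i ∈ Finset.range (l.length + 1), ρ ^ i
        = 1 + ρ * ∑ i ∈ Finset.range l.length, ρ ^ i := by
      rw [Finset.sum_range_succ', Finset.mul_sum, add_comm]
      simp [pow_succ, mul_comm]
    rw [List.length_cons, h2, geomSum]
    nlinarith [mul_le_mul_of_nonneg_left h1 hρ, hm x List.mem_cons_self]

theorem geomSum_nonneg {ρ : ℝ} (hρ : 0 ≤ ρ) (l : List ℝ) (hl : ∀ x ∈ l, 0 ≤ x) :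
    0 ≤ geomSum ρ l := by
  simpa using mul_geom_le_geomSum hρ l hl

theorem sort_cons_eq_orderedInsert (s : Multiset ℝ) (w : ℝ) :
    (w ::ₘ s).sort (fun x y => y ≤ x)
      = (s.sort (fun x y => y ≤ x)).orderedInsert (fun x y => y ≤ x) w := by
  refine List.Perm.eq_of_pairwise' (r := fun x y : ℝ => y ≤ x) (Multiset.pairwise_sort _ _)
    (List.Pairwise.orderedInsert w _ (Multiset.pairwise_sort _ _)) ?_
  refine .trans ?_ (List.perm_orderedInsert (fun x y : ℝ => y ≤ x) w _).symm
  rw [← Multiset.coe_eq_coe]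
  simp [← Multiset.cons_coe]

theorem sort_cons_eq_append (s : Multiset ℝ) {m : ℝ} (hm : ∀ x ∈ s, m ≤ x) :
    (m ::ₘ s).sort (fun x y => y ≤ x) = s.sort (fun x y => y ≤ x) ++ [m] := by
  refine List.Perm.eq_of_pairwise' (r := fun x y : ℝ => y ≤ x) (Multiset.pairwise_sort _ _) ?_ ?_
  · rw [List.pairwise_append]
    exact ⟨Multiset.pairwise_sort _ _, List.pairwise_singleton _ _, by simpa using hm⟩
  · rw [← Multiset.coe_eq_coe, ← Multiset.coe_add, Multiset.sort_eq, Multiset.sort_eq,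
      Multiset.coe_singleton, ← Multiset.singleton_add, add_comm]

end GeometricSums

/-! ### Change of a threshold when an item is accepted -/

section Thresholds

variable {V : Type*}

/-- The weights of the items in `A`, in decreasing order. -/
noncomputable def sortedWeights (A : Finset V) (w : V → ℝ) : List ℝ :=
  (A.val.map w).sort (fun x y => y ≤ x)

theorem length_sortedWeights (A : Finset V) (w : V → ℝ) : (sortedWeights A w).length = A.card := by
  simp [sortedWeights]

theorem mem_sortedWeights {A : Finset V} {w : V → ℝ} {x : ℝ} :
    x ∈ sortedWeights A w ↔ ∃ i ∈ A, w i = x := by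
  simp [sortedWeights]

/-- The threshold that belongs to a set `A` of items of a part with budget `n`. -/
noncomputable def threshold (n : ℕ) (d : ℝ) (A : Finset V) (w : V → ℝ) : ℝ :=
  ∑ i ∈ Finset.Icc 1 n, ithLargest A w i * gCoef n d i

theorem threshold_congr {n : ℕ} {d : ℝ} {A : Finset V} {w w' : V → ℝ} (h : ∀ i ∈ A, w i = w' i) :
    threshold n d A w = threshold n d A w' := by
  have : A.val.map w = A.val.map w' := Multiset.map_congr rfl h
  simp only [threshold, ithLargest, this]

theorem threshold_empty (n : ℕ) (d : ℝ) (w : V → ℝ) : threshold n d ∅ w = 0 := by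
  simp [threshold, ithLargest]

theorem threshold_eq_geomSum {n : ℕ} (d : ℝ) {A : Finset V} (w : V → ℝ) (hA : A.card ≤ n) :
    threshold n d A w = cCoef n d / n * geomSum (1 + d / n) (sortedWeights A w) := by
  rw [geomSum_eq_sum_range _ _ n ((length_sortedWeights A w).trans_le hA), Finset.mul_sum,
    threshold, Finset.range_eq_Ico, ← Finset.Ico_add_one_right_eq_Icc,
    Finset.sum_Ico_eq_sum_range, ← Finset.range_eq_Ico]
  refine Finset.sum_congr rfl fun i _ => ?_
  simp only [ithLargest, gCoef, sortedWeights, Nat.add_sub_cancel_left]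
  ring

theorem one_lt_pow_base {n : ℕ} {d : ℝ} (hn : 1 ≤ n) (hd : 0 < d) : 1 < (1 + d / n) ^ n := by
  have : (0 : ℝ) < n := by exact_mod_cast hn
  exact one_lt_pow₀ (by linarith [div_pos hd this]) (by omega)

theorem cCoef_pos {n : ℕ} {d : ℝ} (hn : 1 ≤ n) (hd : 0 < d) : 0 < cCoef n d :=
  div_pos (by linarith) (sub_pos.2 (one_lt_pow_base hn hd))

theorem cCoef_mul {n : ℕ} {d : ℝ} (hn : 1 ≤ n) (hd : 0 < d) :
    cCoef n d * ((1 + d / n) ^ n - 1) = 1 + d :=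
  div_mul_cancel₀ _ (sub_pos.2 (one_lt_pow_base hn hd)).ne'

theorem threshold_nonneg {n : ℕ} {d : ℝ} (hn : 1 ≤ n) (hd : 0 < d) {A : Finset V} {w : V → ℝ}
    (hA : A.card ≤ n) (hw : ∀ i ∈ A, 0 ≤ w i) : 0 ≤ threshold n d A w := by
  rw [threshold_eq_geomSum d w hA]
  have := cCoef_pos hn hd
  refine mul_nonneg (by positivity) (geomSum_nonneg (by positivity) _ fun x hx => ?_)
  obtain ⟨i, hi, rfl⟩ := mem_sortedWeights.1 hx
  exact hw i hi

/-- The effect of the arrival of an item of weight `x` on the threshold, in terms of the sorted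
weights `l` of the items that stay and of the weight `m` that is lost. -/
theorem threshold_increment {n : ℕ} {d : ℝ} (hn : 1 ≤ n) (hd : 0 < d) {l : List ℝ}
    {β β' m x : ℝ} (hl : l.Pairwise (fun x y => y ≤ x)) (hml : ∀ y ∈ l, m ≤ y) (hm : 0 ≤ m)
    (hlen : m = 0 ∨ l.length + 1 = n)
    (hβ : β = cCoef n d / n * geomSum (1 + d / n) (l ++ [m]))
    (hβ' : β' = cCoef n d / n * geomSum (1 + d / n) (l.orderedInsert (fun x y => y ≤ x) x))
    (hx : β ≤ x) :
    (1 + d) * m ≤ d * β ∧ β ≤ β' ∧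
      n * (β' - β) ≤ cCoef n d * (x - m) + d * β - (1 + d) * m := by
  have hn0 : (0 : ℝ) < n := by exact_mod_cast hn
  have hc := cCoef_pos hn hd
  have hcm := cCoef_mul hn hd
  set c := cCoef n d
  have hdn := div_pos hd hn0
  have hρ : 1 ≤ 1 + d / n := by linarith
  -- For `m = 0` the exponent is irrelevant; otherwise it equals `n`. Thus the normalization of
  -- `cCoef` applies in both cases.
  have key : (1 + d / n) ^ (l.length + 1) * m = (1 + d / n) ^ n * m := by
    rcases hlen with h | h <;> simp [h]
  have hcβ : n * β = c * geomSum (1 + d / n) (l ++ [m]) := by rw [hβ]; field_simp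
  have hcβ' : n * β' = c * geomSum (1 + d / n) (l.orderedInsert (fun x y => y ≤ x) x) := by
    rw [hβ']; field_simp
  have h1 : (1 + d) * m ≤ d * β := by
    rcases hlen with h | h
    · subst h
      have : 0 ≤ β := by
        rw [hβ]
        refine mul_nonneg (by positivity) (geomSum_nonneg (by positivity) _ ?_)
        intro y hy
        rcases List.mem_append.1 hy with hy | hy
        · exact hml y hy
        · simp [List.mem_singleton.1 hy]
      rw [mul_zero]; positivity
    -- A full part has `n` weights, all at least `m`, so `β` is at least `m` times the sum of all
    -- coefficients, which is `(1 + d) / d`.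
    · have h2 := mul_geom_le_geomSum (ρ := 1 + d / n) (by positivity) (l ++ [m]) (m := m) (by
        intro y hy
        rcases List.mem_append.1 hy with hy | hy
        · exact hml y hy
        · simp [List.mem_singleton.1 hy])
      have h3 : (l ++ [m]).length = n := by simpa using h
      have h4 := geom_sum_mul (1 + d / n) n
      rw [h3] at h2
      rw [add_sub_cancel_left] at h4
      calc (1 + d) * m = d * (c / n) * (m * ∑ i ∈ Finset.range n, (1 + d / n) ^ i) := by
            rw [← hcm, ← h4]; field_simp
        _ ≤ d * (c / n) * geomSum (1 + d / n) (l ++ [m]) := by gcongr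
        _ = d * β := by rw [hβ]; ring
  have hβ0 : m ≤ β := by nlinarith
  refine ⟨h1, ?_, ?_⟩
  · rw [hβ, hβ']
    exact mul_le_mul_of_nonneg_left
      (geomSum_append_le_orderedInsert hρ l hl hml (hβ0.trans hx)) (by positivity)
  -- With ρ = 1 + d/n, putting `x` in front bounds the increase by c x + c (d/n) geomSum l - c ρ^|l|
  -- m = c x + d β - c ρ^(|l|+1) m. By `key`, the last term is (1 + d + c) m.
  · have h2 := mul_le_mul_of_nonneg_left (geomSum_orderedInsert_le hρ x l) hc.le
    have h3 := geomSum_append_singleton (1 + d / n) l m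
    have h4 : d * β = c * ((d / n) * geomSum (1 + d / n) (l ++ [m])) := by
      rw [hβ]; ring
    rw [mul_sub, hcβ', hcβ, h4]
    have h5 : geomSum (1 + d / n) (l ++ [m])
        = geomSum (1 + d / n) l + (1 + d / n) ^ l.length * m := h3
    have h6 : (1 + d) * m = c * ((1 + d / n) * ((1 + d / n) ^ l.length * m) - m) := by
      rw [← mul_assoc, ← pow_succ', key, ← hcm]; ring
    rw [h6, h5]
    nlinarith

theorem threshold_update [DecidableEq V] {n : ℕ} {d : ℝ} (hn : 1 ≤ n) (hd : 0 < d)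
    {A A' : Finset V} {w : V → ℝ} {t : V} (hA : A.card ≤ n) (hw : ∀ i ∈ A, 0 ≤ w i)
    (ht : t ∉ A) (hA' : (A.card < n ∧ A' = insert t A) ∨
      (A.card = n ∧ ∃ j ∈ A, (∀ i ∈ A, w j ≤ w i) ∧ A' = insert t (A.erase j)))
    (hβ : threshold n d A w ≤ w t) :
    ∃ m, ∑ i ∈ A', w i = ∑ i ∈ A, w i + w t - m ∧ A'.card ≤ n ∧ 0 ≤ m ∧
      (1 + d) * m ≤ d * threshold n d A w ∧ threshold n d A w ≤ threshold n d A' w ∧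
      n * (threshold n d A' w - threshold n d A w)
        ≤ cCoef n d * (w t - m) + d * threshold n d A w - (1 + d) * m := by
  rcases hA' with ⟨hlt, rfl⟩ | ⟨hcard, j, hj, hmin, rfl⟩
  · have hc : (insert t A).card ≤ n := by rw [Finset.card_insert_of_notMem ht]; omega
    -- Below the budget nothing is lost; appending the weight 0 leaves the geometric sum unchanged
    -- and unifies this case with replacement.
    refine ⟨0, by rw [Finset.sum_insert ht]; ring, hc, le_rfl, ?_⟩
    refine threshold_increment hn hd (l := sortedWeights A w)
      (Multiset.pairwise_sort _ _) ?_ le_rfl (Or.inl rfl) ?_ ?_ hβ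
    · intro y hy
      obtain ⟨i, hi, rfl⟩ := mem_sortedWeights.1 hy
      exact hw i hi
    · rw [threshold_eq_geomSum d w hA, geomSum_append_singleton, mul_zero, add_zero]
    · rw [threshold_eq_geomSum d w hc, sortedWeights, sortedWeights,
        Finset.insert_val_of_notMem ht, Multiset.map_cons, sort_cons_eq_orderedInsert]
  · have ht' : t ∉ A.erase j := fun h => ht (Finset.mem_of_mem_erase h)
    have hce : (A.erase j).card + 1 = n := by rw [Finset.card_erase_add_one hj, hcard]
    have hc : (insert t (A.erase j)).card ≤ n := by
      rw [Finset.card_insert_of_notMem ht']; omega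
    refine ⟨w j, ?_, hc, hw j hj, ?_⟩
    · rw [Finset.sum_insert ht', ← Finset.add_sum_erase _ _ hj]; ring
    refine threshold_increment hn hd (l := sortedWeights (A.erase j) w)
      (Multiset.pairwise_sort _ _) ?_ (hw j hj) (Or.inr ?_) ?_ ?_ hβ
    · intro y hy
      obtain ⟨i, hi, rfl⟩ := mem_sortedWeights.1 hy
      exact hmin i (Finset.mem_of_mem_erase hi)
    · rw [length_sortedWeights, hce]
    · rw [threshold_eq_geomSum d w hA]
      have : A.val.map w = w j ::ₘ (A.erase j).val.map w := by
        conv_lhs => rw [← Finset.insert_erase hj]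
        rw [Finset.insert_val_of_notMem (Finset.notMem_erase j A), Multiset.map_cons]
      rw [sortedWeights, this, sort_cons_eq_append, sortedWeights]
      intro x hx
      obtain ⟨i, hi, rfl⟩ := Multiset.mem_map.1 hx
      exact hmin i (Finset.mem_of_mem_erase hi)
    · rw [threshold_eq_geomSum d w hc, sortedWeights, sortedWeights,
        Finset.insert_val_of_notMem ht', Multiset.map_cons, sort_cons_eq_orderedInsert]

end Thresholds

/-! ### Expectations over independent coins as recursions -/

section CoinProcesses

variable {V α : Type*}

/-- The expected value of `F` at the end of the process that starts at `x`, processes the items of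
a list and moves by `next`, where the coins are independent and show `true` with probability
`p`. -/
noncomputable def expect (p : ℝ) (next : Bool → α → V → α) (F : α → ℝ) : List V → α → ℝ
  | [], x => F x
  | t :: σ, x =>
    p * expect p next F σ (next true x t) + (1 - p) * expect p next F σ (next false x t)

theorem expect_sub_const_mul (p : ℝ) (next : Bool → α → V → α) (F G : α → ℝ) (c : ℝ)
    (σ : List V) (x : α) :
    expect p next (fun y => F y - c * G y) σ x
      = expect p next F σ x - c * expect p next G σ x := by
  induction σ generalizing x with
  | nil => rfl
  | cons t σ ih => simp only [expect, ih]; ring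

/-- The optional stopping inequality for a potential `Φ` that does not increase in expectation as
long as the invariant `I` holds. -/
theorem expect_le_potential {p : ℝ} (hp0 : 0 ≤ p) (hp1 : p ≤ 1) {next : Bool → α → V → α}
    {F : α → ℝ} (I : List V → α → Prop) (Φ : List V → α → ℝ)
    (hI : ∀ z t σ x, I (t :: σ) x → I σ (next z x t))
    (hΦ : ∀ t σ x, I (t :: σ) x →
      p * Φ σ (next true x t) + (1 - p) * Φ σ (next false x t) ≤ Φ (t :: σ) x)
    (hF : ∀ x, I [] x → F x ≤ Φ [] x) (σ : List V) (x : α) (hx : I σ x) :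
    expect p next F σ x ≤ Φ σ x := by
  induction σ generalizing x with
  | nil => exact hF x hx
  | cons t σ ih =>
    refine le_trans ?_ (hΦ t σ x hx)
    exact add_le_add (mul_le_mul_of_nonneg_left (ih _ (hI _ _ _ _ hx)) hp0)
      (mul_le_mul_of_nonneg_left (ih _ (hI _ _ _ _ hx)) (by linarith))

theorem foldl_invariant {next : Bool → α → V → α} (I : List V → α → Prop)
    (hI : ∀ z t σ x, I (t :: σ) x → I σ (next z x t)) (z : V → Bool) (σ : List V) (x : α)
    (hx : I σ x) : I [] (σ.foldl (fun x t => next (z t) x t) x) := by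
  induction σ generalizing x with
  | nil => exact hx
  | cons t σ ih => exact ih _ (hI _ _ _ _ hx)

section Integral

variable {Ω : Type*} [MeasurableSpace Ω] {μ : Measure Ω}
  [IsProbabilityMeasure μ] {Z : V → Ω → Bool} {p : ℝ}

theorem measureReal_coin_eq (hZ_meas : ∀ t, Measurable (Z t)) (hp0 : 0 ≤ p)
    (hZ_prob : ∀ t, μ {ω | Z t ω = true} = ENNReal.ofReal p) (t : V) (b : Bool) :
    μ.real (Z t ⁻¹' {b}) = if b = true then p else 1 - p := by
  have h1 : μ.real (Z t ⁻¹' {true}) = p := by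
    have : Z t ⁻¹' {true} = {ω | Z t ω = true} := by ext; simp
    rw [this, measureReal_def, hZ_prob, ENNReal.toReal_ofReal hp0]
  cases b with
  | true => simpa using h1
  | false =>
    have : Z t ⁻¹' {false} = (Z t ⁻¹' {true})ᶜ := by ext; simp
    rw [this, probReal_compl_eq_one_sub (hZ_meas t (measurableSet_singleton _)), h1]
    simp

theorem measureReal_cylinder (hZ_meas : ∀ t, Measurable (Z t)) (hZ_indep : iIndepFun Z μ)
    (hp0 : 0 ≤ p) (hZ_prob : ∀ t, μ {ω | Z t ω = true} = ENNReal.ofReal p) (U : Finset V)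
    (b : V → Bool) :
    μ.real (⋂ u ∈ U, Z u ⁻¹' {b u}) = ∏ u ∈ U, if b u = true then p else 1 - p := by
  rw [measureReal_def, hZ_indep.measure_inter_preimage_eq_mul U
    (sets := fun u => {b u}) fun _ _ => measurableSet_singleton _, ENNReal.toReal_prod]
  exact Finset.prod_congr rfl fun u _ => measureReal_coin_eq hZ_meas hp0 hZ_prob u (b u)

/-- Restricting to a cylinder that fixes the coins of `U` lets the induction process one coin at a
time; independence enters only through the probabilities of cylinders. -/
theorem setIntegral_cylinder_foldl [Finite V] [DecidableEq V] (hZ_meas : ∀ t, Measurable (Z t)) (hZ_indep : iIndepFun Z μ)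
    (hp0 : 0 ≤ p) (hZ_prob : ∀ t, μ {ω | Z t ω = true} = ENNReal.ofReal p)
    (next : Bool → α → V → α) (F : α → ℝ) (σ : List V) (hσ : σ.Nodup) (U : Finset V)
    (hU : ∀ t ∈ σ, t ∉ U) (b : V → Bool) (x : α) :
    ∫ ω in ⋂ u ∈ U, Z u ⁻¹' {b u}, F (σ.foldl (fun x t => next (Z t ω) x t) x) ∂μ
      = (∏ u ∈ U, if b u = true then p else 1 - p) * expect p next F σ x := by
  induction σ generalizing U b x with
  | nil =>
    simp only [List.foldl_nil, setIntegral_const, expect, smul_eq_mul]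
    rw [measureReal_cylinder hZ_meas hZ_indep hp0 hZ_prob]
  | cons t σ ih =>
    rw [List.nodup_cons] at hσ
    have htU : t ∉ U := hU t List.mem_cons_self
    have hcyl : ∀ z : Bool, (⋂ u ∈ insert t U, Z u ⁻¹' {Function.update b t z u})
        = Z t ⁻¹' {z} ∩ ⋂ u ∈ U, Z u ⁻¹' {b u} := by
      intro z
      rw [Finset.set_biInter_insert, Function.update_self]
      congr 1
      refine Set.iInter₂_congr fun u hu => ?_
      rw [Function.update_of_ne (by rintro rfl; exact htU hu)]
    have hmeas : ∀ (U : Finset V) (b : V → Bool), MeasurableSet (⋂ u ∈ U, Z u ⁻¹' {b u}) :=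
      fun U b => Finset.measurableSet_biInter _ fun u _ => hZ_meas u (measurableSet_singleton _)
    have hint : Integrable
        (fun ω => F ((t :: σ).foldl (fun x t => next (Z t ω) x t) x)) μ := by
      -- `α` carries no σ-algebra; integrability comes from the finite cube of coin outcomes, on
      -- which every function is measurable and bounded.
      let G : (V → Bool) → ℝ := fun z => F ((t :: σ).foldl (fun x t => next (z t) x t) x)
      have hG : Measurable G := measurable_of_finite G
      obtain ⟨C, hC⟩ := (Set.finite_range fun z => ‖G z‖).bddAbove
      exact Integrable.of_bound
        (hG.comp (measurable_pi_iff.2 hZ_meas : Measurable fun ω v => Z v ω)).aestronglyMeasurable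
        C (ae_of_all _ fun ω => hC ⟨fun v => Z v ω, rfl⟩)
    have hsplit : (⋂ u ∈ U, Z u ⁻¹' {b u})
        = (⋂ u ∈ insert t U, Z u ⁻¹' {Function.update b t true u})
          ∪ ⋂ u ∈ insert t U, Z u ⁻¹' {Function.update b t false u} := by
      rw [hcyl, hcyl, ← Set.union_inter_distrib_right]
      refine (Set.inter_eq_right.2 fun ω _ => ?_).symm
      cases h : Z t ω <;> simp [h]
    have hdisj : Disjoint (⋂ u ∈ insert t U, Z u ⁻¹' {Function.update b t true u})
        (⋂ u ∈ insert t U, Z u ⁻¹' {Function.update b t false u}) := by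
      rw [hcyl, hcyl, Set.disjoint_left]
      rintro ω ⟨h1, -⟩ ⟨h2, -⟩
      simp only [Set.mem_preimage, Set.mem_singleton_iff] at h1 h2
      simp [h1] at h2
    have hbranch : ∀ z : Bool, ∫ ω in ⋂ u ∈ insert t U, Z u ⁻¹' {Function.update b t z u},
        F ((t :: σ).foldl (fun x t => next (Z t ω) x t) x) ∂μ
        = (if z = true then p else 1 - p) * (∏ u ∈ U, if b u = true then p else 1 - p)
          * expect p next F σ (next z x t) := by
      intro z
      have h1 := ih hσ.2 (insert t U) (fun u hu => by
        rw [Finset.mem_insert, not_or]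
        exact ⟨by rintro rfl; exact hσ.1 hu, hU u (List.mem_cons_of_mem _ hu)⟩)
        (Function.update b t z) (next z x t)
      rw [Finset.prod_insert htU, Function.update_self,
        Finset.prod_congr rfl fun u hu => by
          rw [Function.update_of_ne (by rintro rfl; exact htU hu)]] at h1
      rw [← h1]
      refine setIntegral_congr_fun (hmeas _ _) fun ω hω => ?_
      have : Z t ω = z := by rw [hcyl] at hω; exact hω.1
      simp only [List.foldl_cons, this]
    rw [hsplit, setIntegral_union hdisj (hmeas _ _) hint.integrableOn hint.integrableOn,
      hbranch, hbranch, expect]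
    simp only [if_true, Bool.false_eq_true, if_false]
    ring

theorem integral_foldl_eq_expect [Finite V] [DecidableEq V] (hZ_meas : ∀ t, Measurable (Z t)) (hZ_indep : iIndepFun Z μ)
    (hp0 : 0 ≤ p) (hZ_prob : ∀ t, μ {ω | Z t ω = true} = ENNReal.ofReal p)
    (next : Bool → α → V → α) (F : α → ℝ) (σ : List V) (hσ : σ.Nodup) (x : α) :
    ∫ ω, F (σ.foldl (fun x t => next (Z t ω) x t) x) ∂μ = expect p next F σ x := by
  simpa using setIntegral_cylinder_foldl hZ_meas hZ_indep hp0 hZ_prob next F σ hσ ∅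
    (by simp) (fun _ => true) x

end Integral

end CoinProcesses

/-! ### Submodular functions of a randomly growing set -/

section Submodularity

variable {V : Type*} [DecidableEq V] {f : Finset V → ℝ}

theorem Submodular.insert_sub_le (hf : Submodular f) {X Y : Finset V} {t : V} (hXY : X ⊆ Y)
    (ht : t ∉ Y) : f (insert t Y) - f Y ≤ f (insert t X) - f X := by
  have h := hf (insert t X) Y
  have h1 : insert t X ∪ Y = insert t Y := by
    rw [Finset.insert_union, Finset.union_eq_right.2 hXY]
  have h2 : insert t X ∩ Y = X := by
    rw [Finset.insert_inter_of_notMem ht, Finset.inter_eq_left.2 hXY]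
  rw [h1, h2] at h
  linarith

theorem Submodular.union_left (hf : Submodular f) (A : Finset V) :
    Submodular fun T => f (A ∪ T) := by
  intro X Y
  have h := hf (A ∪ X) (A ∪ Y)
  rwa [← Finset.union_union_distrib_left, ← Finset.union_inter_distrib_left] at h

/-- If a random set grows from `T x` only by insertion of arriving items whose coin shows `true`,
then the expected value of a submodular function of the random set is at least a mixture of its
values at `T x` and at some larger set. -/
theorem Submodular.exists_le_expect {α : Type*} (hf : Submodular f) {p : ℝ} (hp0 : 0 ≤ p)
    (hp1 : p ≤ 1) {next : Bool → α → V → α} (T : α → Finset V)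
    (hfalse : ∀ x t, T (next false x t) = T x)
    (htrue : ∀ x t, T (next true x t) = T x ∨ T (next true x t) = insert t (T x))
    (σ : List V) (hσ : σ.Nodup) (x : α) (hx : ∀ t ∈ σ, t ∉ T x) :
    ∃ Y : Finset V, (∀ y ∈ Y, y ∈ σ) ∧
      (1 - p) * f (T x) + p * f (T x ∪ Y) ≤ expect p next (fun y => f (T y)) σ x := by
  induction σ generalizing x with
  | nil => exact ⟨∅, by simp, by simp only [Finset.union_empty, expect]; linarith⟩
  | cons t σ ih =>
    rw [List.nodup_cons] at hσ
    have hq : 0 ≤ 1 - p := by linarith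
    obtain ⟨Y₀, hY₀, h₀⟩ := ih hσ.2 (next false x t) (by
      rw [hfalse]; exact fun u hu => hx u (List.mem_cons_of_mem _ hu))
    rw [hfalse] at h₀
    have h0 := mul_le_mul_of_nonneg_left h₀ hq
    -- A convex combination is at least its smaller term, so the sets of the two branches can be
    -- merged into a single `Y`.
    have choose_set : ∀ Y₁ Y₂ : Finset V, (∀ y ∈ Y₁, y ∈ t :: σ) → (∀ y ∈ Y₂, y ∈ t :: σ) →
        (1 - p) * f (T x) + p * (p * f (T x ∪ Y₁) + (1 - p) * f (T x ∪ Y₂))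
          ≤ expect p next (fun y => f (T y)) (t :: σ) x →
        ∃ Y : Finset V, (∀ y ∈ Y, y ∈ t :: σ) ∧
          (1 - p) * f (T x) + p * f (T x ∪ Y)
            ≤ expect p next (fun y => f (T y)) (t :: σ) x := by
      intro Y₁ Y₂ hY₁ hY₂ h
      rcases le_total (f (T x ∪ Y₁)) (f (T x ∪ Y₂)) with hle | hle
      · refine ⟨Y₁, hY₁, le_trans ?_ h⟩
        nlinarith [mul_nonneg (mul_nonneg hp0 hq) (sub_nonneg.2 hle)]
      · refine ⟨Y₂, hY₂, le_trans ?_ h⟩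
        nlinarith [mul_nonneg (mul_nonneg hp0 hp0) (sub_nonneg.2 hle)]
    rcases htrue x t with ht | ht
    · obtain ⟨Y₁, hY₁, h₁⟩ := ih hσ.2 (next true x t) (by
        rw [ht]; exact fun u hu => hx u (List.mem_cons_of_mem _ hu))
      rw [ht] at h₁
      refine choose_set Y₁ Y₀ (fun y hy => List.mem_cons_of_mem _ (hY₁ y hy))
        (fun y hy => List.mem_cons_of_mem _ (hY₀ y hy)) ?_
      rw [expect]
      nlinarith [mul_le_mul_of_nonneg_left h₁ hp0]
    · obtain ⟨Y₁, hY₁, h₁⟩ := ih hσ.2 (next true x t) (by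
        rw [ht]
        intro u hu
        rw [Finset.mem_insert, not_or]
        exact ⟨by rintro rfl; exact hσ.1 hu, hx u (List.mem_cons_of_mem _ hu)⟩)
      rw [ht] at h₁
      have hins : ∀ Y : Finset V, (∀ y ∈ Y, y ∈ σ) → ∀ y ∈ insert t Y, y ∈ t :: σ := by
        intro Y hY y hy
        rcases Finset.mem_insert.1 hy with rfl | hy
        · exact List.mem_cons_self
        · exact List.mem_cons_of_mem _ (hY y hy)
      refine choose_set (insert t Y₁) (insert t Y₀) (hins _ hY₁) (hins _ hY₀) ?_
      -- The cross terms of weight p (1 - p) are f(T + t) and f(T ∪ Y₀). Submodularity trades them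
      -- for f(T) and f(T ∪ Y₀ + t), so that `t` joins the larger sets only.
      have hsub := hf.insert_sub_le (X := T x) (Y := T x ∪ Y₀) (t := t)
        Finset.subset_union_left (by
          rw [Finset.mem_union, not_or]
          exact ⟨hx t List.mem_cons_self, fun h => hσ.1 (hY₀ t h)⟩)
      rw [Finset.union_insert, Finset.union_insert, expect]
      rw [Finset.insert_union] at h₁
      nlinarith [mul_le_mul_of_nonneg_left h₁ hp0,
        mul_le_mul_of_nonneg_left hsub (mul_nonneg hp0 hq)]

end Submodularity

/-! ### Invariants of the run and the potential argument -/

section Potential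

variable {V : Type*} {k : ℕ}

theorem inPart_subset (part : V → Fin k) (a : Fin k) (A : Finset V) : inPart part a A ⊆ A :=
  Finset.filter_subset _ _

theorem sum_inPart (part : V → Fin k) (A : Finset V) (w : V → ℝ) :
    ∑ a, ∑ i ∈ inPart part a A, w i = ∑ i ∈ A, w i :=
  Finset.sum_fiberwise A part w

variable [DecidableEq V]

theorem inPart_insert_self (part : V → Fin k) (t : V) (A : Finset V) :
    inPart part (part t) (insert t A) = insert t (inPart part (part t) A) := by
  simp [inPart, Finset.filter_insert]

theorem inPart_insert_of_ne {part : V → Fin k} {t : V} {a : Fin k} (h : a ≠ part t)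
    (A : Finset V) : inPart part a (insert t A) = inPart part a A := by
  simp [inPart, Finset.filter_insert, h.symm]

theorem inPart_erase (part : V → Fin k) (a : Fin k) (t : V) (A : Finset V) :
    inPart part a (A.erase t) = (inPart part a A).erase t := by
  simp [inPart, Finset.filter_erase]

theorem sum_eq_add_sub_of_ne {ι : Type*} [Fintype ι] {F F' : ι → ℝ} (a : ι)
    (h : ∀ b, b ≠ a → F' b = F b) : ∑ b, F' b = ∑ b, F b + (F' a - F a) := by
  have : ∑ b, (F' b - F b) = F' a - F a :=
    Fintype.sum_eq_single a fun b hb => by rw [h b hb, sub_self]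
  rw [Finset.sum_sub_distrib] at this
  linarith

/-- The items that were accepted, together with the items of `A` that have arrived, when the
items of `σ` are still to come. -/
def seen (A : Finset V) (σ : List V) (T : Finset V) : Finset V :=
  T ∪ (A \ σ.toFinset)

theorem sdiff_toFinset_of_mem {A : Finset V} {t : V} {σ : List V} (htσ : t ∉ σ) (ht : t ∈ A) :
    A \ σ.toFinset = insert t (A \ (t :: σ).toFinset) := by
  ext u
  by_cases hu : u = t
  · subst hu; simp [ht, htσ]
  · simp [hu]

theorem sdiff_toFinset_of_notMem {A : Finset V} {t : V} {σ : List V} (ht : t ∉ A) :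
    A \ σ.toFinset = A \ (t :: σ).toFinset := by
  ext u
  by_cases hu : u = t
  · subst hu; simp [ht]
  · simp [hu]

theorem seen_of_mem {A T : Finset V} {t : V} {σ : List V} (htσ : t ∉ σ) (ht : t ∈ A) :
    seen A σ T = insert t (seen A (t :: σ) T) := by
  rw [seen, seen, sdiff_toFinset_of_mem htσ ht, Finset.union_insert]

theorem seen_of_notMem {A T : Finset V} {t : V} {σ : List V} (ht : t ∉ A) :
    seen A σ T = seen A (t :: σ) T := by
  rw [seen, seen, ← sdiff_toFinset_of_notMem ht]

theorem seen_insert {A T : Finset V} {t : V} {σ : List V} (htσ : t ∉ σ) :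
    seen A σ (insert t T) = insert t (seen A (t :: σ) T) := by
  by_cases ht : t ∈ A
  · rw [seen_of_mem htσ ht, seen, Finset.insert_union, Finset.insert_idem, seen]
  · rw [seen_of_notMem ht, seen, Finset.insert_union, seen]

theorem notMem_seen {A T : Finset V} {t : V} {σ : List V} (ht : t ∉ T) :
    t ∉ seen A (t :: σ) T := by
  simp [seen, ht]

variable (f : Finset V → ℝ) (part : V → Fin k) (n : Fin k → ℕ) (d : Fin k → ℝ)
  (argmin : V → Finset V → (V → ℝ) → V)

/-- A step of the algorithm that also records the set of all items accepted so far. -/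
noncomputable def trackedStep (z : Bool) (x : AlgState V k × Finset V) (t : V) :
    AlgState V k × Finset V :=
  (step f part n d argmin z x.1 t,
    if x.1.β (part t) ≤ f (insert t x.1.S) - f x.1.S ∧ z = true then insert t x.2 else x.2)

theorem fst_foldl_trackedStep (z : V → Bool) (σ : List V) (x : AlgState V k × Finset V) :
    (σ.foldl (fun x t => trackedStep f part n d argmin (z t) x t) x).1
      = σ.foldl (fun s t => step f part n d argmin (z t) s t) x.1 := by
  induction σ generalizing x with
  | nil => rfl
  | cons t σ ih => exact ih _

/-- The properties that hold throughout the run, when the items of `σ` are still to come. -/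
structure Invariant (A : Finset V) (σ : List V) (x : AlgState V k × Finset V) : Prop where
  nodup : σ.Nodup
  subset : x.1.S ⊆ x.2
  fresh : ∀ t ∈ σ, t ∉ x.2
  card_le : ∀ a, (inPart part a x.1.S).card ≤ n a
  threshold_eq : ∀ a, x.1.β a = threshold (n a) (d a) (inPart part a x.1.S) x.1.w
  weight_nonneg : ∀ i ∈ x.1.S, 0 ≤ x.1.w i
  -- All subsets are needed, since replacement deletes items from the solution.
  le_value : ∀ X ⊆ x.1.S, f ∅ + ∑ i ∈ X, x.1.w i ≤ f X
  value_le : f (seen A σ x.2) ≤ f ∅ + ∑ i ∈ seen A σ x.2, x.1.w i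

variable {f part n d argmin}

theorem trackedStep_of_reject {z : Bool} {x : AlgState V k × Finset V} {t : V}
    (h : ¬(x.1.β (part t) ≤ f (insert t x.1.S) - f x.1.S ∧ z = true)) :
    trackedStep f part n d argmin z x t =
      ({ S := x.1.S, w := Function.update x.1.w t (f (insert t x.1.S) - f x.1.S), β := x.1.β },
        x.2) := by
  have h' : ¬(f (insert t x.1.S) - f x.1.S - x.1.β (part t) ≥ 0 ∧ z = true) := by
    rwa [ge_iff_le, sub_nonneg]
  simp only [trackedStep, step, Function.update_self, if_neg h, if_neg h']

theorem sum_update_of_notMem {A : Finset V} {w : V → ℝ} {t : V} (ht : t ∉ A) (y : ℝ) :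
    ∑ i ∈ A, Function.update w t y i = ∑ i ∈ A, w i :=
  Finset.sum_congr rfl fun i hi => by rw [Function.update_of_ne (by rintro rfl; exact ht hi)]

namespace Invariant

variable {A : Finset V} {σ : List V} {x : AlgState V k × Finset V} {t : V}

theorem beta_nonneg (h : Invariant f part n d A σ x) (hn : ∀ a, 1 ≤ n a) (hd : ∀ a, 0 < d a)
    (a : Fin k) : 0 ≤ x.1.β a := by
  rw [h.threshold_eq]
  exact threshold_nonneg (hn a) (hd a) (h.card_le a) fun i hi =>
    h.weight_nonneg i (inPart_subset _ _ _ hi)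

/-- The weight of `t` is its marginal over the solution, a subset of the seen set, so it is at least
the marginal over the seen set. -/
theorem value_le_insert (hf : Submodular f) (h : Invariant f part n d A (t :: σ) x) :
    f (insert t (seen A (t :: σ) x.2)) ≤ f ∅ + ∑ i ∈ insert t (seen A (t :: σ) x.2),
      Function.update x.1.w t (f (insert t x.1.S) - f x.1.S) i := by
  have htU : t ∉ seen A (t :: σ) x.2 := notMem_seen (h.fresh t List.mem_cons_self)
  rw [Finset.sum_insert htU, Function.update_self, sum_update_of_notMem htU]
  have := hf.insert_sub_le (X := x.1.S) (Y := seen A (t :: σ) x.2)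
    (h.subset.trans Finset.subset_union_left) htU
  have := h.value_le
  linarith

theorem reject (hf : Submodular f) (h : Invariant f part n d A (t :: σ) x) :
    Invariant f part n d A σ
      ({ S := x.1.S, w := Function.update x.1.w t (f (insert t x.1.S) - f x.1.S), β := x.1.β },
        x.2) := by
  obtain ⟨htσ, hσ⟩ := List.nodup_cons.1 h.nodup
  have htT := h.fresh t List.mem_cons_self
  have htS : t ∉ x.1.S := fun hm => htT (h.subset hm)
  have hne : ∀ i ∈ x.1.S, Function.update x.1.w t (f (insert t x.1.S) - f x.1.S) i = x.1.w i :=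
    fun i hi => Function.update_of_ne (by rintro rfl; exact htS hi) _ _
  refine ⟨hσ, h.subset, fun u hu => h.fresh u (List.mem_cons_of_mem _ hu), h.card_le, ?_, ?_, ?_,
    ?_⟩
  · intro a
    exact (h.threshold_eq a).trans
      (threshold_congr fun i hi => (hne i (inPart_subset _ _ _ hi)).symm)
  · intro i hi
    exact (h.weight_nonneg i hi).trans_eq (hne i hi).symm
  · intro X hX
    dsimp only at hX ⊢
    rw [sum_update_of_notMem fun hm => htS (hX hm)]
    exact h.le_value X hX
  · by_cases htA : t ∈ A
    · rw [seen_of_mem htσ htA]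
      exact h.value_le_insert hf
    · rw [seen_of_notMem htA]
      dsimp only
      rw [sum_update_of_notMem (notMem_seen htT)]
      exact h.value_le

/-- The effect of the acceptance of `t`, where `m` is the weight lost by the replacement. -/
theorem accept (hf : Submodular f) (hargmin : IsArgminRule argmin) (hn : ∀ a, 1 ≤ n a)
    (hd : ∀ a, 0 < d a) (h : Invariant f part n d A (t :: σ) x)
    (hacc : x.1.β (part t) ≤ f (insert t x.1.S) - f x.1.S) :
    ∃ (s : AlgState V k) (β' m : ℝ), trackedStep f part n d argmin true x t = (s, insert t x.2) ∧
      Invariant f part n d A σ (s, insert t x.2) ∧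
      s.w = Function.update x.1.w t (f (insert t x.1.S) - f x.1.S) ∧
      s.β = Function.update x.1.β (part t) β' ∧
      ∑ i ∈ s.S, s.w i = ∑ i ∈ x.1.S, x.1.w i + (f (insert t x.1.S) - f x.1.S) - m ∧
      0 ≤ m ∧ (1 + d (part t)) * m ≤ d (part t) * x.1.β (part t) ∧ x.1.β (part t) ≤ β' ∧
      n (part t) * (β' - x.1.β (part t))
        ≤ cCoef (n (part t)) (d (part t)) * (f (insert t x.1.S) - f x.1.S - m)
          + d (part t) * x.1.β (part t) - (1 + d (part t)) * m := by
  obtain ⟨htσ, hσ⟩ := List.nodup_cons.1 h.nodup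
  have htT := h.fresh t List.mem_cons_self
  have htS : t ∉ x.1.S := fun hm => htT (h.subset hm)
  set a := part t with ha
  set y := f (insert t x.1.S) - f x.1.S with hy
  set w := Function.update x.1.w t y with hw
  have hwt : w t = y := Function.update_self _ _ _
  have hne : ∀ i ∈ x.1.S, w i = x.1.w i :=
    fun i hi => Function.update_of_ne (by rintro rfl; exact htS hi) _ _
  have hβ : ∀ b, x.1.β b = threshold (n b) (d b) (inPart part b x.1.S) w := fun b =>
    (h.threshold_eq b).trans (threshold_congr fun i hi => (hne i (inPart_subset _ _ _ hi)).symm)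
  have hβ0 := h.beta_nonneg hn hd a
  let S' := if (inPart part a x.1.S).card < n a then insert t x.1.S
      else insert t (x.1.S.erase (argmin t (inPart part a x.1.S) w))
  have hS'sub : S' ⊆ insert t x.1.S := by
    dsimp only [S']
    split_ifs
    · exact subset_rfl
    · exact Finset.insert_subset_insert _ (Finset.erase_subset _ _)
  have hfull : ¬(inPart part a x.1.S).card < n a → (inPart part a x.1.S).Nonempty := by
    intro hlt
    rw [← Finset.card_pos]
    have := hn a
    omega
  have hA' : ((inPart part a x.1.S).card < n a ∧ inPart part a S' = insert t (inPart part a x.1.S))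
      ∨ ((inPart part a x.1.S).card = n a ∧ ∃ j ∈ inPart part a x.1.S,
        (∀ i ∈ inPart part a x.1.S, w j ≤ w i) ∧
        inPart part a S' = insert t ((inPart part a x.1.S).erase j)) := by
    by_cases hlt : (inPart part a x.1.S).card < n a
    · exact Or.inl ⟨hlt, by simp only [S', if_pos hlt, ha, inPart_insert_self]⟩
    · have hj := hargmin t _ w (hfull hlt)
      exact Or.inr ⟨le_antisymm (h.card_le a) (not_lt.1 hlt), _, hj.1, hj.2,
        by simp only [S', if_neg hlt, ha, inPart_insert_self, inPart_erase]⟩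
  have hother : ∀ b, b ≠ a → inPart part b S' = inPart part b x.1.S := by
    intro b hb
    by_cases hlt : (inPart part a x.1.S).card < n a
    · simp only [S', if_pos hlt, inPart_insert_of_ne hb]
    · have hj := (hargmin t _ w (hfull hlt)).1
      simp only [S', if_neg hlt, inPart_insert_of_ne hb, inPart_erase]
      refine Finset.erase_eq_of_notMem fun hjb => hb ?_
      rw [← (Finset.mem_filter.1 hjb).2, (Finset.mem_filter.1 hj).2]
  obtain ⟨m, hsum, hcard, hm0, hmβ, hmono, hinc⟩ := threshold_update (hn a) (hd a) (h.card_le a)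
    (fun i hi => by
      rw [hne i (inPart_subset _ _ _ hi)]
      exact h.weight_nonneg i (inPart_subset _ _ _ hi))
    (fun hm => htS (inPart_subset _ _ _ hm)) hA' (by rw [← hβ a, hwt]; exact hacc)
  rw [← hβ a] at hmβ hmono hinc
  rw [hwt] at hsum hinc
  set β' := threshold (n a) (d a) (inPart part a S') w with hβ'
  refine ⟨⟨S', w, Function.update x.1.β a β'⟩, β', m, ?_, ?_, rfl, rfl, ?_, hm0, hmβ, hmono, hinc⟩
  · have h' : f (insert t x.1.S) - f x.1.S - x.1.β (part t) ≥ 0 ∧ True :=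
      ⟨sub_nonneg.2 hacc, trivial⟩
    have h'' : x.1.β (part t) ≤ f (insert t x.1.S) - f x.1.S ∧ True := ⟨hacc, trivial⟩
    simp only [trackedStep, step, Function.update_self, if_pos h', if_pos h'']
    rfl
  · refine ⟨hσ, hS'sub.trans (Finset.insert_subset_insert _ h.subset), ?_, ?_, ?_, ?_, ?_, ?_⟩
    · intro u hu
      rw [Finset.mem_insert, not_or]
      exact ⟨by rintro rfl; exact htσ hu, h.fresh u (List.mem_cons_of_mem _ hu)⟩
    · intro b
      by_cases hb : b = a
      · rw [hb]; exact hcard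
      · dsimp only
        rw [hother b hb]; exact h.card_le b
    · intro b
      by_cases hb : b = a
      · rw [hb]; exact Function.update_self _ _ _
      · dsimp only
        rw [hother b hb, Function.update_of_ne hb]
        exact hβ b
    · intro i hi
      rcases Finset.mem_insert.1 (hS'sub hi) with rfl | hi
      · dsimp only; rw [hwt]; exact hβ0.trans hacc
      · exact (h.weight_nonneg i hi).trans_eq (hne i hi).symm
    · intro X hX
      dsimp only at hX ⊢
      have hX' := hX.trans hS'sub
      by_cases htX : t ∈ X
      · have hXS : X.erase t ⊆ x.1.S := by
          rwa [← Finset.subset_insert_iff]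
        have h1 := hf.insert_sub_le hXS htS
        rw [Finset.insert_erase htX] at h1
        have h2 := h.le_value _ hXS
        rw [← Finset.add_sum_erase _ _ htX, hwt,
          Finset.sum_congr rfl fun i hi => hne i (hXS hi)]
        linarith
      · have hXS : X ⊆ x.1.S := (Finset.subset_insert_iff_of_notMem htX).1 hX'
        rw [Finset.sum_congr rfl fun i hi => hne i (hXS hi)]
        exact h.le_value X hXS
    · rw [seen_insert htσ]
      exact h.value_le_insert hf
  · dsimp only
    rw [← Finset.sum_congr rfl hne, ← sum_inPart part S', ← sum_inPart part x.1.S,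
      sum_eq_add_sub_of_ne a fun b hb => by rw [hother b hb], hsum]
    ring

theorem trackedStep (hf : Submodular f) (hargmin : IsArgminRule argmin) (hn : ∀ a, 1 ≤ n a)
    (hd : ∀ a, 0 < d a) (z : Bool) (h : Invariant f part n d A (t :: σ) x) :
    Invariant f part n d A σ (trackedStep f part n d argmin z x t) := by
  by_cases hacc : x.1.β (part t) ≤ f (insert t x.1.S) - f x.1.S ∧ z = true
  · obtain ⟨s, _, _, hs, hI, -⟩ := h.accept hf hargmin hn hd hacc.1
    rw [hacc.2, hs]
    exact hI
  · rw [trackedStep_of_reject hacc]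
    exact h.reject hf

end Invariant

/-- The start of the algorithm. -/
noncomputable def initialState (V : Type*) (k : ℕ) : AlgState V k × Finset V :=
  ({ S := ∅, w := fun _ => 0, β := fun _ => 0 }, ∅)

theorem invariant_initialState {A : Finset V} {σ : List V} (hσ : σ.Nodup) (hA : ∀ t ∈ A, t ∈ σ) :
    Invariant f part n d A σ (initialState V k) := by
  have hseen : seen A σ ∅ = ∅ := by
    rw [seen, Finset.empty_union, Finset.sdiff_eq_empty_iff_subset]
    exact fun t ht => List.mem_toFinset.2 (hA t ht)
  have hin : ∀ a, inPart part a ∅ = ∅ := fun a => Finset.filter_empty _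
  refine ⟨hσ, subset_rfl, by simp [initialState], ?_, ?_, by simp [initialState], ?_, ?_⟩
  · intro a; simp [initialState, hin]
  · intro a; simp [initialState, hin, threshold_empty]
  · intro X hX
    rw [Finset.subset_empty.1 hX]
    simp
  · simp [initialState, hseen]

/-- The number of items of part `a` that `A` may still contain besides those that have arrived. -/
noncomputable def slack (part : V → Fin k) (n : Fin k → ℕ) (A : Finset V) (σ : List V)
    (a : Fin k) : ℝ :=
  n a - (inPart part a (A \ σ.toFinset)).card

theorem slack_le (part : V → Fin k) (n : Fin k → ℕ) (A : Finset V) (σ : List V) (a : Fin k) :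
    slack part n A σ a ≤ n a := by
  simp [slack]

theorem slack_of_mem {A : Finset V} {σ : List V} {t : V} (htσ : t ∉ σ) (ht : t ∈ A) :
    slack part n A σ (part t) = slack part n A (t :: σ) (part t) - 1 := by
  rw [slack, slack, sdiff_toFinset_of_mem htσ ht, inPart_insert_self, Finset.card_insert_of_notMem]
  · push_cast; ring
  · simp [inPart]

theorem slack_of_notMem {A : Finset V} {σ : List V} {t : V} (ht : t ∉ A) (a : Fin k) :
    slack part n A σ a = slack part n A (t :: σ) a := by
  rw [slack, slack, sdiff_toFinset_of_notMem ht]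

theorem slack_of_ne {A : Finset V} {σ : List V} {t : V} (htσ : t ∉ σ) {a : Fin k}
    (ha : a ≠ part t) : slack part n A σ a = slack part n A (t :: σ) a := by
  by_cases ht : t ∈ A
  · rw [slack, slack, sdiff_toFinset_of_mem htσ ht, inPart_insert_of_ne ha]
  · exact slack_of_notMem ht a

/-- The potential function of the analysis. -/
noncomputable def potential (f : Finset V → ℝ) (part : V → Fin k) (n : Fin k → ℕ) (q : ℝ)
    (A : Finset V) (σ : List V) (x : AlgState V k × Finset V) : ℝ :=
  f ∅ + ∑ i ∈ seen A σ x.2, x.1.w i + ∑ a, slack part n A σ a * x.1.β a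
    - q * (f ∅ + ∑ i ∈ x.1.S, x.1.w i)

/-- Acceptance of an item outside `A`. Bounding `d * β` by `d * y` turns the increment into exactly
(1 + c + d)(y - m). -/
theorem weight_add_slack_le {N c d q m y β β' M : ℝ} (hd : 0 < d)
    (hM : M ≤ N) (hm : 0 ≤ m) (hmβ : (1 + d) * m ≤ d * β) (hββ' : β ≤ β')
    (hinc : N * (β' - β) ≤ c * (y - m) + d * β - (1 + d) * m) (hβy : β ≤ y)
    (hq : 1 + c + d ≤ q) : y + M * (β' - β) ≤ q * (y - m) := by
  have h1 : M * (β' - β) ≤ N * (β' - β) := mul_le_mul_of_nonneg_right hM (by linarith)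
  have h2 : d * β ≤ d * y := mul_le_mul_of_nonneg_left hβy hd.le
  have h3 : d * m ≤ d * β := by linarith
  have h4 : m ≤ y := (le_of_mul_le_mul_left h3 hd).trans hβy
  have h5 := mul_le_mul_of_nonneg_right hq (sub_nonneg.2 h4)
  nlinarith

/-- Acceptance of an item of `A`, which uses one unit of slack. Split y - m into (y - β) + (β - m):
with e = 1 - 1/N their coefficients on the left are 1/p + e c and e (c + d), both at most `q`. -/
theorem surplus_add_slack_le {N c d p q m y β β' M : ℝ} (hN : 1 ≤ N) (hc : 0 < c) (hd : 0 < d)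
    (hM : M ≤ N) (hm : 0 ≤ m) (hmβ : (1 + d) * m ≤ d * β) (hββ' : β ≤ β')
    (hinc : N * (β' - β) ≤ c * (y - m) + d * β - (1 + d) * m) (hβy : β ≤ y)
    (hq : 1 + c + d ≤ q) (hq' : (1 - 1 / N) * c + 1 / p ≤ q) :
    1 / p * (y - β) + (M - 1) * (β' - β) ≤ q * (y - m) := by
  have hN0 : 0 < N := by linarith
  have he0 : 0 ≤ 1 - 1 / N := by
    rw [sub_nonneg, div_le_one hN0]; exact hN
  have he1 : 1 - 1 / N ≤ 1 := by linarith [one_div_pos.2 hN0]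
  have h1 : (M - 1) * (β' - β) ≤ (N - 1) * (β' - β) :=
    mul_le_mul_of_nonneg_right (by linarith) (by linarith)
  have h2 : (N - 1) * (β' - β) = (1 - 1 / N) * (N * (β' - β)) := by field_simp
  have h3 := mul_le_mul_of_nonneg_left hinc he0
  set e := 1 - 1 / N
  have hmb : m ≤ β := le_of_mul_le_mul_left (by linarith : d * m ≤ d * β) hd
  have h4 : (1 / p) * (y - β) ≤ (q - e * c) * (y - β) :=
    mul_le_mul_of_nonneg_right (by linarith) (by linarith)
  have hec : e * c ≤ c := by nlinarith
  have hed : e * d ≤ d := by nlinarith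
  have h5 : e * d * (β - m) ≤ (q - e * c) * (β - m) :=
    mul_le_mul_of_nonneg_right (by linarith) (by linarith)
  have h6 : 0 ≤ e * m := mul_nonneg he0 hm
  nlinarith

theorem potential_step {p q : ℝ} (hp0 : 0 < p) (hf : Submodular f)
    (hargmin : IsArgminRule argmin) (hn : ∀ a, 1 ≤ n a) (hd : ∀ a, 0 < d a)
    (hq : ∀ a, 1 + cCoef (n a) (d a) + d a ≤ q)
    (hq' : ∀ a, (1 - 1 / (n a : ℝ)) * cCoef (n a) (d a) + 1 / p ≤ q) {A : Finset V} {σ : List V}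
    {x : AlgState V k × Finset V} {t : V} (h : Invariant f part n d A (t :: σ) x) :
    p * potential f part n q A σ (trackedStep f part n d argmin true x t)
      + (1 - p) * potential f part n q A σ (trackedStep f part n d argmin false x t)
      ≤ potential f part n q A (t :: σ) x := by
  obtain ⟨htσ, -⟩ := List.nodup_cons.1 h.nodup
  have htT := h.fresh t List.mem_cons_self
  have htS : t ∉ x.1.S := fun hm => htT (h.subset hm)
  have htU : t ∉ seen A (t :: σ) x.2 := notMem_seen htT
  -- A rejected item of `A` still counts as seen: its weight is added and one unit of slack, worth
  -- the threshold, is removed.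
  have hreject : potential f part n q A σ
      ({ S := x.1.S, w := Function.update x.1.w t (f (insert t x.1.S) - f x.1.S), β := x.1.β },
        x.2) = potential f part n q A (t :: σ) x
        + if t ∈ A then f (insert t x.1.S) - f x.1.S - x.1.β (part t) else 0 := by
    simp only [potential]
    rw [sum_update_of_notMem htS]
    by_cases htA : t ∈ A
    · rw [seen_of_mem htσ htA, Finset.sum_insert htU, sum_update_of_notMem htU,
        Function.update_self, if_pos htA,
        sum_eq_add_sub_of_ne (F := fun b => slack part n A (t :: σ) b * x.1.β b) (part t)
          fun b hb => by rw [slack_of_ne htσ hb],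
        slack_of_mem htσ htA]
      ring
    · have hs : slack part n A σ = slack part n A (t :: σ) := funext (slack_of_notMem htA)
      rw [seen_of_notMem htA, sum_update_of_notMem htU, if_neg htA, hs, add_zero]
  rw [trackedStep_of_reject (z := false) (by simp), hreject]
  by_cases hacc : x.1.β (part t) ≤ f (insert t x.1.S) - f x.1.S
  · obtain ⟨s, β', m, hs, -, hw, hβ, hsum, hm0, hmβ, hmono, hinc⟩ :=
      h.accept hf hargmin hn hd hacc
    have haccept : potential f part n q A σ (s, insert t x.2)
        = potential f part n q A (t :: σ) x + (f (insert t x.1.S) - f x.1.S)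
          + (slack part n A σ (part t) * β' - slack part n A (t :: σ) (part t) * x.1.β (part t))
          - q * (f (insert t x.1.S) - f x.1.S - m) := by
      simp only [potential]
      rw [hsum, hw, hβ, seen_insert htσ, Finset.sum_insert htU, sum_update_of_notMem htU,
        Function.update_self,
        sum_eq_add_sub_of_ne (F := fun b => slack part n A (t :: σ) b * x.1.β b) (part t)
          fun b hb => by rw [slack_of_ne htσ hb, Function.update_of_ne hb], Function.update_self]
      ring
    rw [hs, haccept]
    have hM := slack_le part n A (t :: σ) (part t)
    by_cases htA : t ∈ A
    · have key := surplus_add_slack_le (by exact_mod_cast hn (part t))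
        (cCoef_pos (hn _) (hd _)) (hd _) hM hm0 hmβ hmono hinc hacc (hq _) (hq' _)
      have key' := mul_le_mul_of_nonneg_left key hp0.le
      rw [mul_add, ← mul_assoc, mul_one_div_cancel hp0.ne'] at key'
      rw [if_pos htA, slack_of_mem htσ htA]
      linarith
    · have key := weight_add_slack_le (hd _) hM hm0 hmβ hmono hinc hacc (hq _)
      have key' := mul_le_mul_of_nonneg_left key hp0.le
      rw [if_neg htA, slack_of_notMem htA]
      linarith
  -- Below the threshold both coins reject, and the surplus is negative.
  · rw [trackedStep_of_reject (fun h => hacc h.1), hreject]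
    split_ifs <;> linarith

theorem expect_sub_le {p q : ℝ} (hp0 : 0 < p) (hp1 : p ≤ 1) (hf : Submodular f)
    (hf0 : 0 ≤ f ∅) (hargmin : IsArgminRule argmin) (hn : ∀ a, 1 ≤ n a) (hd : ∀ a, 0 < d a)
    (hq1 : 1 ≤ q) (hq : ∀ a, 1 + cCoef (n a) (d a) + d a ≤ q)
    (hq' : ∀ a, (1 - 1 / (n a : ℝ)) * cCoef (n a) (d a) + 1 / p ≤ q) {A : Finset V}
    (hA : Independent part n A) {σ : List V} (hσ : σ.Nodup) (hAσ : ∀ t ∈ A, t ∈ σ) :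
    expect p (trackedStep f part n d argmin) (fun x => f (A ∪ x.2) - q * f x.1.S) σ
      (initialState V k) ≤ 0 := by
  have hI : Invariant f part n d A σ (initialState V k) := invariant_initialState hσ hAσ
  refine (expect_le_potential hp0.le hp1 (Invariant f part n d A) (potential f part n q A)
    (fun z t σ x h => h.trackedStep hf hargmin hn hd z)
    (fun t σ x h => potential_step hp0 hf hargmin hn hd hq hq' h) ?_ σ _ hI).trans ?_
  · intro x h
    have h1 := h.value_le
    have h2 := h.le_value _ subset_rfl
    have h3 : 0 ≤ ∑ a, slack part n A [] a * x.1.β a := by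
      refine Finset.sum_nonneg fun a _ => mul_nonneg ?_ (h.beta_nonneg hn hd a)
      have : ((inPart part a A).card : ℝ) ≤ n a := by exact_mod_cast hA a
      simpa [slack] using this
    have h4 : seen A [] x.2 = A ∪ x.2 := by simp [seen, Finset.union_comm]
    have h5 := mul_le_mul_of_nonneg_left h2 (by linarith : 0 ≤ q)
    rw [potential]
    rw [h4] at h1 ⊢
    linarith
  · have hseen : seen A σ ∅ = ∅ := by
      rw [seen, Finset.empty_union, Finset.sdiff_eq_empty_iff_subset]
      exact fun t ht => List.mem_toFinset.2 (hAσ t ht)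
    simp only [potential, initialState, hseen, mul_zero, add_zero, Finset.sum_const_zero]
    nlinarith

theorem le_expect_value {p q : ℝ} (hp0 : 0 < p) (hp1 : p ≤ 1) (hf : Submodular f)
    (hf_nonneg : ∀ A, 0 ≤ f A) (hargmin : IsArgminRule argmin) (hn : ∀ a, 1 ≤ n a)
    (hd : ∀ a, 0 < d a) (hq1 : 1 ≤ q) (hq : ∀ a, 1 + cCoef (n a) (d a) + d a ≤ q)
    (hq' : ∀ a, (1 - 1 / (n a : ℝ)) * cCoef (n a) (d a) + 1 / p ≤ q) {A : Finset V}
    (hA : Independent part n A) {σ : List V} (hσ : σ.Nodup) (hAσ : ∀ t ∈ A, t ∈ σ) :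
    (1 - p) * f A
      ≤ q * expect p (trackedStep f part n d argmin) (fun x => f x.1.S) σ (initialState V k) := by
  have h1 := expect_sub_le hp0 hp1 hf (hf_nonneg ∅) hargmin hn hd hq1 hq hq' hA hσ hAσ
  rw [expect_sub_const_mul] at h1
  -- The sampling estimate is applied to the function T ↦ f(A ∪ T) from T = ∅; nonnegativity of `f`
  -- discards the term with `Y`.
  obtain ⟨Y, -, hY⟩ := (hf.union_left A).exists_le_expect hp0.le hp1
    (next := trackedStep f part n d argmin) Prod.snd
    (fun x t => by simp [trackedStep])
    (fun x t => by simp only [trackedStep]; split_ifs <;> simp) σ hσ (initialState V k)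
    (by simp [initialState])
  have h2 : A ∪ (initialState V k).2 = A := by simp [initialState]
  rw [h2] at hY
  have := mul_nonneg hp0.le (hf_nonneg (A ∪ ((initialState V k).2 ∪ Y)))
  linarith

end Potential

/-! ### Numerical bounds for the parameters -/

section Parameters

/-- From log(1 + x) ≥ 2x/(x + 2) one gets n log(1 + d/n) ≥ d - d²/(2n); then e^(-u) ≥ 1 - u. -/
theorem exp_mul_le_pow {n : ℕ} {d : ℝ} (hn : 1 ≤ n) (hd : 0 ≤ d) :
    Real.exp d * (1 - d ^ 2 / (2 * n)) ≤ (1 + d / n) ^ n := by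
  have hn0 : (0 : ℝ) < n := by exact_mod_cast hn
  have hx : 0 ≤ d / n := by positivity
  have h1 := Real.le_log_one_add_of_nonneg hx
  have h2 : d - d ^ 2 / (2 * n) ≤ n * (2 * (d / n) / (d / n + 2)) := by
    have h3 : n * (2 * (d / n) / (d / n + 2)) = 2 * d * n / (d + 2 * n) := by field_simp
    rw [h3, le_div_iff₀ (by positivity)]
    have h4 : (d - d ^ 2 / (2 * n)) * (d + 2 * n) = 2 * d * n - d ^ 3 / (2 * n) := by
      field_simp; ring
    have h5 : 0 ≤ d ^ 3 / (2 * n) := by positivity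
    linarith
  calc Real.exp d * (1 - d ^ 2 / (2 * n))
      ≤ Real.exp d * Real.exp (-(d ^ 2 / (2 * n))) := by
        gcongr
        linarith [Real.add_one_le_exp (-(d ^ 2 / (2 * n)))]
    _ = Real.exp (d - d ^ 2 / (2 * n)) := by rw [← Real.exp_add, sub_eq_add_neg]
    _ ≤ Real.exp (n * Real.log (1 + d / n)) :=
        Real.exp_le_exp.2 (h2.trans (mul_le_mul_of_nonneg_left h1 hn0.le))
    _ = (1 + d / n) ^ n := by
        rw [mul_comm, Real.exp_mul, Real.exp_log (by positivity), Real.rpow_natCast]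

theorem exp_seven_thirds_gt : (10.31 : ℝ) < Real.exp ((1 - 0.3) / 0.3) := by
  have h1 : Real.exp ((1 - 0.3) / 0.3) ^ 3 = Real.exp 1 ^ 7 := by
    rw [← Real.exp_nat_mul, ← Real.exp_nat_mul]; norm_num
  have h2 : (2.718281828 : ℝ) ^ 7 < Real.exp 1 ^ 7 := by
    gcongr; linarith [Real.exp_one_gt_d9]
  refine lt_of_pow_lt_pow_left₀ 3 (Real.exp_pos _).le ?_
  rw [h1]
  exact lt_trans (by norm_num) h2

theorem exp_large_gt : (7.04 : ℝ) < Real.exp 1.9532 := by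
  have h1 : Real.exp 1.9532 = Real.exp 1 ^ 2 * Real.exp (-0.0468) := by
    rw [← Real.exp_nat_mul, ← Real.exp_add]; norm_num
  have h2 : (2.718281828 : ℝ) ^ 2 < Real.exp 1 ^ 2 := by
    gcongr; linarith [Real.exp_one_gt_d9]
  have h3 : (0.9532 : ℝ) ≤ Real.exp (-0.0468) := by
    linarith [Real.add_one_le_exp (-0.0468 : ℝ)]
  rw [h1]
  calc (7.04 : ℝ) < 2.718281828 ^ 2 * 0.9532 := by norm_num
    _ ≤ _ := by gcongr

theorem cCoef_le {n : ℕ} {d B C : ℝ} (hC : 0 < C) (hB : 1 < B)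
    (hB' : B ≤ (1 + d / n) ^ n) (h : 1 + d ≤ C * (B - 1)) : cCoef n d ≤ C := by
  rw [cCoef, div_le_iff₀ (by linarith)]
  exact h.trans (by gcongr)

theorem smallD_of_ge {m : ℕ} (hm : 11 ≤ m) : smallD m = (1 - 0.3) / 0.3 := by
  obtain ⟨j, rfl⟩ := Nat.exists_eq_add_of_le' hm
  simp [smallD]

theorem smallBound_of_ge {m : ℕ} (hm : 11 ≤ m) :
    smallBound m = 0.1896 * (1 - 0.7771 / (m : ℝ)) := by
  obtain ⟨j, rfl⟩ := Nat.exists_eq_add_of_le' hm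
  simp [smallBound]

theorem one_le_smallD {m : ℕ} (hm : 1 ≤ m) : 1 ≤ smallD m := by
  by_cases h : 11 ≤ m
  · rw [smallD_of_ge h]; norm_num
  · interval_cases m <;> norm_num [smallD]

/-- The constants are read off from the target: 0.7 / (0.1896 (1 - 0.7771 x)) ≥ 3.6919 (1 + 0.7771
x), where x = 1/m, and 1 + d = 10/3 is subtracted. -/
theorem cCoef_small_le {m : ℕ} (hm : 11 ≤ m) :
    cCoef m ((1 - 0.3) / 0.3) ≤ 0.3586 + 2.869 / m := by
  have hm' : (11 : ℝ) ≤ m := by exact_mod_cast hm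
  have hm0 : (0 : ℝ) < m := by linarith
  have h1 := exp_mul_le_pow (n := m) (d := (1 - 0.3) / 0.3) (by omega) (by norm_num)
  have hx1 : (m : ℝ)⁻¹ ≤ 11⁻¹ := inv_anti₀ (by norm_num) hm'
  have hx0 : 0 < (m : ℝ)⁻¹ := inv_pos.2 hm0
  have h2 : ((1 - 0.3) / 0.3 : ℝ) ^ 2 / (2 * m) = 49 / 18 * (m : ℝ)⁻¹ := by
    field_simp; norm_num
  rw [h2] at h1
  rw [div_eq_mul_inv (2.869 : ℝ)]
  set x := (m : ℝ)⁻¹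
  refine cCoef_le (B := 10.31 * (1 - 49 / 18 * x)) (by positivity) (by linarith)
    (le_trans ?_ h1) ?_
  · exact mul_le_mul_of_nonneg_right exp_seven_thirds_gt.le (by linarith)
  · nlinarith

/-- Here 1 - p = 1.9532 / 2.9532; dividing by 0.1921 (1 - 0.7676 x) and subtracting 1 + d = 2.9532
leaves, to first order in x = 1/m, the stated bound. -/
theorem cCoef_large_le {m : ℕ} (hm : 11 ≤ m) :
    cCoef m 1.9532 ≤ 0.4897 + 2.642 / m := by
  have hm' : (11 : ℝ) ≤ m := by exact_mod_cast hm
  have hm0 : (0 : ℝ) < m := by linarith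
  have h1 := exp_mul_le_pow (n := m) (d := 1.9532) (by omega) (by norm_num)
  have hx1 : (m : ℝ)⁻¹ ≤ 11⁻¹ := inv_anti₀ (by norm_num) hm'
  have hx0 : 0 < (m : ℝ)⁻¹ := inv_pos.2 hm0
  have h2 : (1.9532 : ℝ) ^ 2 / (2 * m) = 1.9532 ^ 2 / 2 * (m : ℝ)⁻¹ := by
    field_simp
  rw [h2] at h1
  rw [div_eq_mul_inv (2.642 : ℝ)]
  set x := (m : ℝ)⁻¹
  refine cCoef_le (B := 7.04 * (1 - 1.9532 ^ 2 / 2 * x)) (by positivity)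
    (by linarith) (le_trans ?_ h1) ?_
  · exact mul_le_mul_of_nonneg_right exp_large_gt.le (by linarith)
  · nlinarith

variable {k : ℕ} [NeZero k] {n : Fin k → ℕ}

theorem minBudget_le (n : Fin k → ℕ) (a : Fin k) : minBudget n ≤ n a :=
  Finset.inf'_le _ (Finset.mem_univ a)

theorem probParam_of_le (h : minBudget n ≤ 10) : probParam n = 0.3 := if_pos h

theorem probParam_of_ge (h : 11 ≤ minBudget n) : probParam n = 1 / (1.9532 + 1) :=
  if_neg (by omega)

theorem dParam_of_le (h : minBudget n ≤ 10) (a : Fin k) : dParam n a = smallD (n a) := if_pos h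

theorem dParam_of_ge (h : 11 ≤ minBudget n) (a : Fin k) : dParam n a = 1.9532 :=
  if_neg (by omega)

theorem probParam_pos (n : Fin k → ℕ) : 0 < probParam n := by
  rw [probParam]; split_ifs <;> norm_num

theorem probParam_lt_one (n : Fin k → ℕ) : probParam n < 1 := by
  rw [probParam]; split_ifs <;> norm_num

theorem one_le_dParam (hn : ∀ a, 1 ≤ n a) (a : Fin k) : 1 ≤ dParam n a := by
  rw [dParam]
  split_ifs
  · exact one_le_smallD (hn a)
  · norm_num

theorem one_le_Q (hn : ∀ a, 1 ≤ n a) (a : Fin k) : 1 ≤ Q n a := by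
  have hd := one_le_dParam hn a
  have hc := cCoef_pos (hn a) (by linarith : 0 < dParam n a)
  exact le_trans (by linarith) (le_max_left _ _)

/-- Covers large budgets, and budgets at least 11 in the small case: there d = (1 - p)/p, and the
second term of the maximum is smaller by c / n. -/
theorem Q_eq_of_one_div_probParam_eq (hn : ∀ a, 1 ≤ n a) (a : Fin k)
    (h : 1 / probParam n = 1 + dParam n a) :
    Q n a = 1 + cCoef (n a) (dParam n a) + dParam n a := by
  have hd := one_le_dParam hn a
  have hc := cCoef_pos (hn a) (by linarith : 0 < dParam n a)
  have h1 : 0 ≤ 1 / (n a : ℝ) := by positivity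
  rw [Q, h, max_eq_left]
  nlinarith

/-- Finitely many rational inequalities. For `m = 1` the bound is attained: the maximum is 4 and 0.7
/ 4 = 0.175. -/
theorem smallBound_le_small {m : ℕ} (hm0 : 1 ≤ m) (hm : m ≤ 10) :
    smallBound m ≤ (1 - 0.3) / max (1 + cCoef m (smallD m) + smallD m)
      ((1 - 1 / (m : ℝ)) * cCoef m (smallD m) + 1 / 0.3) := by
  have key : ∀ b u v : ℝ, 0 < u → b * u ≤ 1 - 0.3 → b * v ≤ 1 - 0.3 →
      b ≤ (1 - 0.3) / max u v := by
    intro b u v hu h1 h2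
    rw [le_div_iff₀ (lt_max_of_lt_left hu)]
    rcases max_choice u v with h | h <;> rw [h] <;> assumption
  refine key _ _ _ ?_ ?_ ?_
  · have hd := one_le_smallD hm0
    have hc := cCoef_pos hm0 (by linarith : 0 < smallD m)
    linarith
  · interval_cases m <;> norm_num [smallBound, smallD, cCoef]
  · interval_cases m <;> norm_num [smallBound, smallD, cCoef]

theorem smallBound_le (hn : ∀ a, 1 ≤ n a) (h : minBudget n ≤ 10) (a : Fin k) :
    smallBound (n a) ≤ (1 - probParam n) / Q n a := by
  by_cases hm : n a ≤ 10
  · rw [Q, probParam_of_le h, dParam_of_le h]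
    exact smallBound_le_small (hn a) hm
  · have hm11 : 11 ≤ n a := by omega
    have hd : dParam n a = (1 - 0.3) / 0.3 := by rw [dParam_of_le h, smallD_of_ge hm11]
    rw [le_div_iff₀ (by linarith [one_le_Q hn a]), Q_eq_of_one_div_probParam_eq hn a
      (by rw [probParam_of_le h, hd]; norm_num), hd, probParam_of_le h, smallBound_of_ge hm11]
    have hc := cCoef_small_le hm11
    have hm' : (11 : ℝ) ≤ n a := by exact_mod_cast hm11
    have hx1 : (n a : ℝ)⁻¹ ≤ 11⁻¹ := inv_anti₀ (by norm_num) hm'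
    have hx0 : 0 < (n a : ℝ)⁻¹ := inv_pos.2 (by linarith)
    rw [div_eq_mul_inv (2.869 : ℝ)] at hc
    rw [div_eq_mul_inv 0.7771]
    set x := (n a : ℝ)⁻¹
    have h1 : 0 ≤ 0.1896 * (1 - 0.7771 * x) := by linarith
    refine (mul_le_mul_of_nonneg_left (add_le_add_left (add_le_add_right hc 1) _) h1).trans ?_
    nlinarith

theorem largeBound_le (hn : ∀ a, 1 ≤ n a) (h : 11 ≤ minBudget n) (a : Fin k) :
    0.1921 * (1 - 0.7676 / (n a : ℝ)) ≤ (1 - probParam n) / Q n a := by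
  have hm11 : 11 ≤ n a := h.trans (minBudget_le n a)
  have hd := dParam_of_ge h a
  rw [le_div_iff₀ (by linarith [one_le_Q hn a]), Q_eq_of_one_div_probParam_eq hn a
    (by rw [probParam_of_ge h, hd]; norm_num), hd, probParam_of_ge h]
  have hc := cCoef_large_le hm11
  have hm' : (11 : ℝ) ≤ n a := by exact_mod_cast hm11
  have hx1 : (n a : ℝ)⁻¹ ≤ 11⁻¹ := inv_anti₀ (by norm_num) hm'
  have hx0 : 0 < (n a : ℝ)⁻¹ := inv_pos.2 (by linarith)
  rw [div_eq_mul_inv (2.642 : ℝ)] at hc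
  rw [div_eq_mul_inv 0.7676]
  set x := (n a : ℝ)⁻¹
  have h1 : 0 ≤ 0.1921 * (1 - 0.7676 * x) := by linarith
  refine (mul_le_mul_of_nonneg_left (add_le_add_left (add_le_add_right hc 1) _) h1).trans ?_
  nlinarith

theorem exists_ratio_eq (n : Fin k → ℕ) : ∃ a, ratio n = (1 - probParam n) / Q n a := by
  obtain ⟨a, -, ha⟩ := Finset.exists_mem_eq_sup' Finset.univ_nonempty (Q n)
  exact ⟨a, by rw [ratio, ha]⟩

theorem largeBound_le_ratio (hn : ∀ a, 1 ≤ n a) (h : 11 ≤ minBudget n) :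
    0.1921 * (1 - 0.7676 / (minBudget n : ℝ)) ≤ ratio n := by
  obtain ⟨a, ha⟩ := exists_ratio_eq n
  rw [ha]
  refine le_trans ?_ (largeBound_le hn h a)
  have h1 : (minBudget n : ℝ) ≤ n a := by exact_mod_cast minBudget_le n a
  have h2 : (0 : ℝ) < minBudget n := by
    have : (11 : ℝ) ≤ minBudget n := by exact_mod_cast h
    linarith
  gcongr

theorem le_smallBound {m : ℕ} (hm : 1 ≤ m) : 0.175 ≤ smallBound m := by
  by_cases h : 11 ≤ m
  · have hm' : (11 : ℝ) ≤ m := by exact_mod_cast h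
    have h1 : (0.7771 : ℝ) / m ≤ 0.7771 / 11 := by gcongr
    rw [smallBound_of_ge h]
    linarith
  · interval_cases m <;> norm_num [smallBound]

theorem le_ratio (hn : ∀ a, 1 ≤ n a) : 0.175 ≤ ratio n := by
  by_cases h : minBudget n ≤ 10
  · obtain ⟨a, ha⟩ := exists_ratio_eq n
    rw [ha]
    exact (le_smallBound (hn a)).trans (smallBound_le hn h a)
  · have h11 : 11 ≤ minBudget n := by omega
    refine le_trans ?_ (largeBound_le_ratio hn h11)
    have hm' : (11 : ℝ) ≤ minBudget n := by exact_mod_cast h11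
    have h1 : (0.7676 : ℝ) / minBudget n ≤ 0.7676 / 11 := by gcongr
    linarith

theorem exists_forall_sub_le_ratio (ε : ℝ) (hε : 0 < ε) :
    ∃ N : ℕ, ∀ (k : ℕ) [NeZero k] (n : Fin k → ℕ), N ≤ minBudget n → 0.1921 - ε ≤ ratio n := by
  -- Since 0.1921 · 0.7676 < 1, the loss is below 1 / `minBudget n`.
  obtain ⟨M, hM⟩ := exists_nat_gt (1 / ε)
  refine ⟨max M 11, fun k _ n hN => ?_⟩
  have h11 : 11 ≤ minBudget n := (le_max_right _ _).trans hN
  have hm : (M : ℝ) ≤ minBudget n := by exact_mod_cast (le_max_left _ _).trans hN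
  refine le_trans ?_ (largeBound_le_ratio (fun a => ?_) h11)
  · have h0 : (0 : ℝ) < minBudget n := 
      lt_of_lt_of_le (by norm_num : (0 : ℝ) < 11) (by exact_mod_cast h11)
    have h1 : 1 / (minBudget n : ℝ) ≤ ε := by
      rw [div_le_comm₀ h0 hε]; linarith
    have h2 : (0.7676 : ℝ) / minBudget n = 0.7676 * (1 / minBudget n) := by ring
    rw [h2]
    linarith
  · have := minBudget_le n a
    omega

end Parameters

end PartitionSubmod

theorem mainTheorem3 {V : Type*} [Fintype V] [DecidableEq V] {k : ℕ} [NeZero k]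
    (f : Finset V → ℝ) (hf_nonneg : ∀ A, 0 ≤ f A) (hf : PartitionSubmod.Submodular f)
    (part : V → Fin k) (n : Fin k → ℕ) (hn : ∀ a, 1 ≤ n a)
    (argmin : V → Finset V → (V → ℝ) → V) (hargmin : PartitionSubmod.IsArgminRule argmin)
    (σ : List V) (hσ_nodup : σ.Nodup) (hσ_all : ∀ t, t ∈ σ)
    {Ω : Type*} [MeasurableSpace Ω] (μ : Measure Ω) [IsProbabilityMeasure μ]
    (Z : V → Ω → Bool) (hZ_meas : ∀ t, Measurable (Z t)) (hZ_indep : iIndepFun Z μ)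
    (hZ_prob : ∀ t, μ {ω | Z t ω = true} = ENNReal.ofReal (PartitionSubmod.probParam n)) :
    -- the output is always feasible
    (∀ ω, PartitionSubmod.Independent part n
      (PartitionSubmod.run f part n (PartitionSubmod.dParam n) argmin σ (fun t => Z t ω))) ∧
    -- its expected value is at least the ratio times the value of any feasible set
    (∀ A : Finset V, PartitionSubmod.Independent part n A →
      PartitionSubmod.ratio n * f A ≤
        ∫ ω, f (PartitionSubmod.run f part n (PartitionSubmod.dParam n) argmin σ
          (fun t => Z t ω)) ∂μ) ∧
    -- the bounds for the individual parts, in the small and in the large budget case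
    (PartitionSubmod.minBudget n ≤ 10 → ∀ a, PartitionSubmod.smallBound (n a) ≤
      (1 - PartitionSubmod.probParam n) / PartitionSubmod.Q n a) ∧
    (11 ≤ PartitionSubmod.minBudget n → ∀ a, 0.1921 * (1 - 0.7676 / (n a : ℝ)) ≤
      (1 - PartitionSubmod.probParam n) / PartitionSubmod.Q n a) ∧
    -- the bounds on the ratio
    0.175 ≤ PartitionSubmod.ratio n ∧
    (11 ≤ PartitionSubmod.minBudget n →
      0.1921 * (1 - 0.7676 / (PartitionSubmod.minBudget n : ℝ)) ≤ PartitionSubmod.ratio n) ∧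
    -- the ratio tends to at least `0.1921`, uniformly, as the minimum budget tends to infinity
    (∀ ε : ℝ, 0 < ε → ∃ N : ℕ, ∀ (k' : ℕ) [NeZero k'] (n' : Fin k' → ℕ),
      N ≤ PartitionSubmod.minBudget n' → 0.1921 - ε ≤ PartitionSubmod.ratio n') := by
  have hd : ∀ a, 0 < PartitionSubmod.dParam n a :=
    fun a => lt_of_lt_of_le one_pos (PartitionSubmod.one_le_dParam hn a)
  have hrun : ∀ ω, PartitionSubmod.run f part n (PartitionSubmod.dParam n) argmin σ
      (fun t => Z t ω) = (σ.foldl (fun x t => PartitionSubmod.trackedStep f part n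
        (PartitionSubmod.dParam n) argmin (Z t ω) x t) (PartitionSubmod.initialState V k)).1.S :=
    fun ω => congrArg PartitionSubmod.AlgState.S (PartitionSubmod.fst_foldl_trackedStep f part n
      (PartitionSubmod.dParam n) argmin (fun t => Z t ω) σ (PartitionSubmod.initialState V k)).symm
  refine ⟨fun ω => ?_, fun A hA => ?_, PartitionSubmod.smallBound_le hn,
    PartitionSubmod.largeBound_le hn, PartitionSubmod.le_ratio hn,
    PartitionSubmod.largeBound_le_ratio hn, PartitionSubmod.exists_forall_sub_le_ratio⟩
  · rw [hrun]
    -- Feasibility involves no comparison set, so the invariant is used with `A = ∅`.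
    exact (PartitionSubmod.foldl_invariant
      (PartitionSubmod.Invariant f part n (PartitionSubmod.dParam n) ∅)
      (fun z t σ x h => h.trackedStep hf hargmin hn hd z) (fun t => Z t ω) σ _
      (PartitionSubmod.invariant_initialState hσ_nodup (by simp))).card_le
  · have hQ : ∀ a, PartitionSubmod.Q n a
        ≤ Finset.univ.sup' Finset.univ_nonempty (PartitionSubmod.Q n) :=
      fun a => Finset.le_sup' _ (Finset.mem_univ a)
    have hQ1 := (PartitionSubmod.one_le_Q hn 0).trans (hQ 0)
    have hp := PartitionSubmod.probParam_pos n
    simp only [hrun]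
    rw [PartitionSubmod.integral_foldl_eq_expect hZ_meas hZ_indep hp.le hZ_prob _
      (fun x : PartitionSubmod.AlgState V k × Finset V => f x.1.S) σ hσ_nodup, PartitionSubmod.ratio, div_mul_eq_mul_div,
      div_le_iff₀ (by linarith), mul_comm _ (Finset.univ.sup' _ _)]
    exact PartitionSubmod.le_expect_value hp (PartitionSubmod.probParam_lt_one n).le hf hf_nonneg
      hargmin hn hd hQ1 (fun a => (le_max_left _ _).trans (hQ a))
      (fun a => (le_max_right _ _).trans (hQ a)) hA hσ_nodup fun t _ => hσ_all t
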